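/- **Lemma (Lipschitzian functions I).** Suppose $m$ and $n$ are positive integers, $m \le n$, $U$ is an open subset of $\mathbf R^n$, $V$ is an $m$-dimensional varifold in $U$ (that is, a Radon measure over $U \times \mathbf G(n,m)$, where $\mathbf G(n,m)$ is the space of $m$-dimensional linear subspaces of $\mathbf R^n$), and $Y$ is a finite dimensional normed vector space. Denote by $P_\natural$ the orthogonal projection of $\mathbf R^n$ onto $P \in \mathbf G(n,m)$, by $\|V\|$ the weight of $V$, $\|V\|(A) = V(A \times \mathbf G(n,m))$, by $\delta V(\theta) = \int \operatorname{trace}(P_\natural \circ \mathrm D\theta(x)) \, \mathrm dV(x,P)$, for $\theta \in \mathscr D(U,\mathbf R^n)$ (smooth with compact support), the first variation of $V$, and by $\|\delta V\|$ the largest Borel regular measure over $U$ with $\|\delta V\|(A) = \sup\{\delta V(\theta) : \operatorname{spt}\theta \subset A,\ |\theta| \le 1\}$ for all open $A \subset U$. Suppose $\|\delta V\|$ is a Radon measure, and extend $\delta V$ by continuity to $\mathbf L_1(\|\delta V\|,\mathbf R^n)$. A $\|V\|+\|\delta V\|$ measurable $Y$-valued function $f$ on $U$ belongs to $\mathbf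 T(V,Y)$ (is generalised $V$ weakly differentiable) if and only if there is a $\|V\|$ measurable $\operatorname{Hom}(\mathbf R^n,Y)$-valued function $F$ such that - $\int_{K \cap \{x : |f(x)| \le s\}} \|F\| \, \mathrm d\|V\| < \infty$ whenever $K \subset U$ is compact and $0 \le s < \infty$, and - $(\delta V)((\gamma\circ f)\theta) = \int \gamma(f(x)) \operatorname{trace}(P_\natural \circ \mathrm D\theta(x)) + \langle \theta(x), \mathrm D\gamma(f(x)) \circ F(x)\rangle \, \mathrm dV(x,P)$ whenever $\theta \in \mathscr D(U,\mathbf R^n)$ and $\gamma : Y \to \mathbf R$ is smooth and $\mathrm D\gamma$ has compact support. Such $F$ is unique up to $\|V\|$ null sets and is denoted by $V\,\mathbf Df$. Its operator norm at $x$ is $\|V\,\mathbf Df(x)\|$, and $\|V\|_{(\infty)}$ denotes the $\|V\|$ essential supremum of the (operator) norm. Then the following two statements hold. 1. If $f : U \to Y$ is locally Lipschitzian, then $f \in \mathbf T(V,Y)$ and $$\|V\,\mathbf Df(x)\| \le \lim_{r\to 0+} \operatorname{Lip}(f|\mathbf B(x,r)) \quad \text{for } \|V\| \text{ almost all } x,$$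 where $\mathbf B(x,r)$ is the closed ball with centre $x$ and radius $r$, and $\operatorname{Lip}$ denotes the smallest Lipschitz constant. 2. If $f_i : U \to Y$, $i = 1,2,3,\ldots$, are locally Lipschitzian functions converging to $f : U \to Y$ locally uniformly as $i \to \infty$, and $$\kappa = \sup\{ \|V\|_{(\infty)}(V\,\mathbf Df_i) : i = 1,2,3,\ldots \} < \infty,$$ then $f \in \mathbf T(V,Y)$, $\|V\|_{(\infty)}(V\,\mathbf Df) \le \kappa$, and $$\lim_{i\to\infty} \int \langle V\,\mathbf Df_i, G\rangle \, \mathrm d\|V\| = \int \langle V\,\mathbf Df, G\rangle \, \mathrm d\|V\|$$ whenever $G \in \mathbf L_1(\|V\|, \operatorname{Hom}(\mathbf R^n,Y)^\ast)$. -/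

import Mathlib

open MeasureTheory Filter Topology TopologicalSpace
open scoped ENNReal NNReal Distributions

set_option maxSynthPendingDepth 3

noncomputable section

/-- Euclidean space `ℝⁿ`. -/
abbrev Rn (n : ℕ) : Type := EuclideanSpace ℝ (Fin n)

/-! ### The Grassmannian -/

/-- `G(n,m)`: the set of all `m`-dimensional linear subspaces of `ℝⁿ`. -/
def Grass (n m : ℕ) : Type := {P : Submodule ℝ (Rn n) // Module.finrank ℝ P = m}

/-- `P ↦ P♮`: the orthogonal projection of `ℝⁿ` onto `P`, as an endomorphism of `ℝⁿ`. -/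
def Grass.proj {n m : ℕ} (P : Grass n m) : Rn n →L[ℝ] Rn n := P.1.starProjection

/-- The topology of `G(n,m)` is the one for which `P ↦ P♮` is an embedding into `End(ℝⁿ)`. -/
instance Grass.instTopologicalSpace (n m : ℕ) : TopologicalSpace (Grass n m) :=
  TopologicalSpace.induced Grass.proj inferInstance

/-- `G(n,m)` carries its Borel sigma-algebra. -/
instance Grass.instMeasurableSpace (n m : ℕ) : MeasurableSpace (Grass n m) := borel _

instance Grass.instBorelSpace (n m : ℕ) : BorelSpace (Grass n m) := ⟨rfl⟩

theorem Grass.isInducing_proj (n m : ℕ) :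
    IsInducing (Grass.proj : Grass n m → (Rn n →L[ℝ] Rn n)) := ⟨rfl⟩

theorem Grass.proj_injective (n m : ℕ) :
    Function.Injective (Grass.proj : Grass n m → (Rn n →L[ℝ] Rn n)) := by
  intro P Q h
  exact Subtype.ext (Submodule.starProjection_inj.1 h)

instance Grass.instSecondCountableTopology (n m : ℕ) : SecondCountableTopology (Grass n m) :=
  (Grass.isInducing_proj n m).secondCountableTopology

instance Grass.instT2Space (n m : ℕ) : T2Space (Grass n m) :=
  (IsEmbedding.mk (Grass.isInducing_proj n m) (Grass.proj_injective n m)).t2Space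

/-- The trace of an endomorphism of `ℝⁿ`, as a continuous linear functional. -/
def traceCLM (n : ℕ) : (Rn n →L[ℝ] Rn n) →L[ℝ] ℝ :=
  LinearMap.toContinuousLinearMap
    ((LinearMap.trace ℝ (Rn n)).comp (ContinuousLinearMap.coeLM ℝ))

theorem Grass.range_proj (n m : ℕ) :
    Set.range (Grass.proj : Grass n m → (Rn n →L[ℝ] Rn n)) =
      {A | IsStarProjection A ∧ traceCLM n A = m} := by
  have key : ∀ P : Submodule ℝ (Rn n),
      traceCLM n P.starProjection = Module.finrank ℝ P := by
    intro P
    have h : LinearMap.IsProj P (P.starProjection : Rn n →ₗ[ℝ] Rn n) :=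
      ⟨fun x => P.starProjection_apply_mem x,
        fun x hx => Submodule.starProjection_eq_self_iff.2 hx⟩
    exact h.trace
  ext A
  constructor
  · rintro ⟨P, rfl⟩
    refine ⟨isStarProjection_starProjection, ?_⟩
    rw [Grass.proj, key, P.2]
  · rintro ⟨hA, ht⟩
    obtain ⟨P, _, rfl⟩ := isStarProjection_iff_eq_starProjection.1 hA
    rw [key] at ht
    exact ⟨⟨P, by exact_mod_cast ht⟩, rfl⟩

instance Grass.instCompactSpace (n m : ℕ) : CompactSpace (Grass n m) := by
  rw [← isCompact_univ_iff, (Grass.isInducing_proj n m).isCompact_iff, Set.image_univ]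
  refine Metric.isCompact_of_isClosed_isBounded ?_ ?_
  · rw [Grass.range_proj]
    have : {A : Rn n →L[ℝ] Rn n | IsStarProjection A ∧ traceCLM n A = m} =
        {A | A * A = A} ∩ ({A | star A = A} ∩ {A | traceCLM n A = m}) := by
      ext A
      constructor
      · rintro ⟨⟨h1, h2⟩, h3⟩
        exact ⟨h1, h2, h3⟩
      · rintro ⟨h1, h2, h3⟩
        exact ⟨⟨h1, h2⟩, h3⟩
    rw [this]
    refine IsClosed.inter ?_ (IsClosed.inter ?_ ?_)
    · exact isClosed_eq (continuous_id.mul continuous_id) continuous_id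
    · exact isClosed_eq (ContinuousLinearMap.adjoint (𝕜 := ℝ) (E := Rn n) (F := Rn n)).continuous
        continuous_id
    · exact isClosed_eq (traceCLM n).continuous continuous_const
  · refine (Metric.isBounded_closedBall (x := (0 : Rn n →L[ℝ] Rn n)) (r := 1)).subset ?_
    rintro _ ⟨P, rfl⟩
    rw [mem_closedBall_zero_iff]
    exact P.1.starProjection_norm_le

/-- The inner product `P♮ • B = trace (P♮* ∘ B) = trace (P♮ ∘ B)` on `End(ℝⁿ)`
(the projection `P♮` is symmetric). -/
def Grass.dot {n m : ℕ} (P : Grass n m) (B : Rn n →L[ℝ] Rn n) : ℝ :=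
  LinearMap.trace ℝ (Rn n) (P.proj ∘L B : Rn n →L[ℝ] Rn n)

/-! ### Varifolds and their first variation -/

/-- An `m`-dimensional varifold in the open subset `U` of `ℝⁿ`: a Radon measure
over `U × G(n,m)`. -/
structure Varifold {n : ℕ} (m : ℕ) (U : Opens (Rn n)) where
  /-- The underlying Borel measure. -/
  measure : Measure (U × Grass n m)
  finiteOnCompacts : IsFiniteMeasureOnCompacts measure

namespace Varifold

variable {n m : ℕ} {U : Opens (Rn n)}

/-- The weight measure `‖V‖` over `U`: `‖V‖(A) = V(A × G(n,m))`. -/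
def weight (V : Varifold m U) : Measure U := V.measure.map Prod.fst

/-- The first variation `δV(θ) = ∫ P♮ • Dθ(x) dV(x,P)`, for `θ ∈ 𝓓(U, ℝⁿ)`. -/
def firstVariation (V : Varifold m U) (θ : 𝓓(U, Rn n)) : ℝ :=
  ∫ z : U × Grass n m, z.2.dot (fderiv ℝ θ z.1) ∂V.measure

/-- `sup {δV(θ) : θ ∈ 𝓓(U, ℝⁿ), spt θ ⊆ A, |θ| ≤ 1}`. -/
def variationOn (V : Varifold m U) (A : Set U) : ℝ≥0∞ :=
  ⨆ (θ : 𝓓(U, Rn n)) (_ : tsupport θ ⊆ (↑) '' A ∧ ∀ x, ‖θ x‖ ≤ 1),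
    ENNReal.ofReal (V.firstVariation θ)

theorem integrable_dot (V : Varifold m U) (θ : 𝓓(U, Rn n)) :
    Integrable (fun z : U × Grass n m => z.2.dot (fderiv ℝ θ z.1)) V.measure := by
  have := V.finiteOnCompacts
  have hD : Continuous (fderiv ℝ θ) := θ.contDiff.continuous_fderiv (by simp)
  have hproj : Continuous (Grass.proj : Grass n m → _) := (Grass.isInducing_proj n m).continuous
  have hc : Continuous (fun z : U × Grass n m => z.2.dot (fderiv ℝ θ z.1)) := by
    have : Continuous (fun z : U × Grass n m =>
        traceCLM n (z.2.proj ∘L fderiv ℝ θ (z.1 : Rn n))) :=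
      (traceCLM n).continuous.comp
        ((hproj.comp continuous_snd).clm_comp
          (hD.comp (continuous_subtype_val.comp continuous_fst)))
    exact this
  refine hc.integrable_of_hasCompactSupport ?_
  have hK : IsCompact ((↑) ⁻¹' tsupport θ : Set U) :=
    Topology.IsInducing.subtypeVal.isCompact_preimage' θ.hasCompactSupport
      (by simpa using θ.tsupport_subset)
  refine HasCompactSupport.intro (hK.prod (isCompact_univ (X := Grass n m))) ?_
  rintro ⟨x, P⟩ hx
  have hx' : (x : Rn n) ∉ tsupport θ := fun h => hx ⟨h, trivial⟩
  have h0 : fderiv ℝ θ (x : Rn n) = 0 :=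
    image_eq_zero_of_notMem_tsupport (fun h => hx' (tsupport_fderiv_subset ℝ h))
  simp [Grass.dot, h0]

theorem firstVariation_add (V : Varifold m U) (θ η : 𝓓(U, Rn n)) :
    V.firstVariation (θ + η) = V.firstVariation θ + V.firstVariation η := by
  rw [firstVariation, firstVariation, firstVariation,
    ← integral_add (V.integrable_dot θ) (V.integrable_dot η)]
  refine integral_congr_ae (Eventually.of_forall fun z => ?_)
  have hθ : DifferentiableAt ℝ θ (z.1 : Rn n) := θ.contDiff.differentiable (by simp) _
  have hη : DifferentiableAt ℝ η (z.1 : Rn n) := η.contDiff.differentiable (by simp) _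
  have : fderiv ℝ (θ + η : 𝓓(U, Rn n)) (z.1 : Rn n) =
      fderiv ℝ θ (z.1 : Rn n) + fderiv ℝ η (z.1 : Rn n) := by
    rw [FunLike.coe_add]
    exact fderiv_add hθ hη
  simp only [this, Grass.dot, ContinuousLinearMap.comp_add]
  exact map_add (LinearMap.trace ℝ (Rn n)) _ _

theorem variationOn_mono (V : Varifold m U) {A B : Set U} (h : A ⊆ B) :
    V.variationOn A ≤ V.variationOn B :=
  iSup_mono fun _ => iSup_mono' fun hθ =>
    ⟨⟨hθ.1.trans (Set.image_mono h), hθ.2⟩, le_rfl⟩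

theorem variationOn_empty (V : Varifold m U) : V.variationOn ∅ = 0 := by
  refine le_antisymm (iSup₂_le fun θ hθ => ?_) bot_le
  have h0 : (θ : Rn n → Rn n) = 0 := by
    rw [← tsupport_eq_empty_iff]
    simpa using hθ.1
  simp [firstVariation, h0, Grass.dot]

theorem variationOn_add_le (V : Varifold m U) {A B C : Set U} (hAB : Disjoint A B)
    (hA : A ⊆ C) (hB : B ⊆ C) :
    V.variationOn A + V.variationOn B ≤ V.variationOn C := by
  rw [variationOn, variationOn]
  refine ENNReal.biSup_add_biSup_le' ?_ ?_ ?_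
  · exact ⟨0, by simp [tsupport_eq_empty_iff.2]⟩
  · exact ⟨0, by simp [tsupport_eq_empty_iff.2]⟩
  intro θ hθ η hη
  rcases le_total (V.firstVariation θ) 0 with h1 | h1
  · rw [ENNReal.ofReal_of_nonpos h1, zero_add]
    refine le_trans ?_ (V.variationOn_mono hB)
    exact le_iSup₂ (f := fun (θ : 𝓓(U, Rn n))
      (_ : tsupport θ ⊆ (↑) '' B ∧ ∀ x, ‖θ x‖ ≤ 1) => ENNReal.ofReal (V.firstVariation θ)) η hη
  rcases le_total (V.firstVariation η) 0 with h2 | h2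
  · rw [ENNReal.ofReal_of_nonpos h2, add_zero]
    refine le_trans ?_ (V.variationOn_mono hA)
    exact le_iSup₂ (f := fun (θ : 𝓓(U, Rn n))
      (_ : tsupport θ ⊆ (↑) '' A ∧ ∀ x, ‖θ x‖ ≤ 1) => ENNReal.ofReal (V.firstVariation θ)) θ hθ
  rw [← ENNReal.ofReal_add h1 h2, ← firstVariation_add]
  refine le_iSup₂ (f := fun (θ : 𝓓(U, Rn n))
      (_ : tsupport θ ⊆ (↑) '' C ∧ ∀ x, ‖θ x‖ ≤ 1) =>
        ENNReal.ofReal (V.firstVariation θ)) (θ + η) ⟨?_, ?_⟩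
  · rw [FunLike.coe_add]
    exact (tsupport_add _ _).trans (Set.union_subset
      (hθ.1.trans (Set.image_mono hA)) (hη.1.trans (Set.image_mono hB)))
  · intro x
    have hd : Disjoint (tsupport θ) (tsupport η) :=
      Set.disjoint_of_subset hθ.1 hη.1
        ((Set.disjoint_image_iff Subtype.val_injective).2 hAB)
    rw [FunLike.coe_add, Pi.add_apply]
    by_cases hx : x ∈ tsupport θ
    · rw [image_eq_zero_of_notMem_tsupport (Set.disjoint_left.1 hd hx), add_zero]
      exact hθ.2 x
    · rw [image_eq_zero_of_notMem_tsupport hx, zero_add]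
      exact hη.2 x

/-- The outer measure generated by the values `variationOn A` on open sets `A`: the infimum of
`∑ variationOn (A i)` over countable covers by open sets `A i`. -/
def variationOuter (V : Varifold m U) : OuterMeasure U :=
  inducedOuterMeasure (fun (A : Set U) (_ : IsOpen A) => V.variationOn A)
    isOpen_empty V.variationOn_empty

theorem variationOuter_isMetric (V : Varifold m U) : V.variationOuter.IsMetric := by
  intro s t hst
  refine le_antisymm (measure_union_le s t) ?_
  obtain ⟨r, hr0, hr⟩ := hst
  have hr2 : 0 < r / 2 := ENNReal.half_pos hr0
  set S : Set U := ⋃ x ∈ s, Metric.eball x (r / 2) with hS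
  set T : Set U := ⋃ x ∈ t, Metric.eball x (r / 2) with hT
  have hSo : IsOpen S := isOpen_biUnion fun _ _ => Metric.isOpen_eball
  have hTo : IsOpen T := isOpen_biUnion fun _ _ => Metric.isOpen_eball
  have hsS : s ⊆ S := fun x hx => Set.mem_biUnion hx (Metric.mem_eball_self hr2)
  have htT : t ⊆ T := fun x hx => Set.mem_biUnion hx (Metric.mem_eball_self hr2)
  have hdisj : Disjoint S T := by
    rw [Set.disjoint_left]
    intro z hz hz'
    simp only [hS, hT, Set.mem_iUnion, Metric.mem_eball] at hz hz'
    obtain ⟨x, hx, hzx⟩ := hz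
    obtain ⟨y, hy, hzy⟩ := hz'
    have h1 : edist x y < r / 2 + r / 2 :=
      (edist_triangle_left x y z).trans_lt (ENNReal.add_lt_add hzx hzy)
    rw [ENNReal.add_halves] at h1
    exact absurd (hr x hx y hy) (not_le.2 h1)
  conv_rhs => rw [variationOuter, inducedOuterMeasure, OuterMeasure.ofFunction_apply]
  refine le_iInf₂ fun A hA => ?_
  by_cases hAo : ∀ i, IsOpen (A i)
  swap
  · push Not at hAo
    obtain ⟨i, hi⟩ := hAo
    refine le_trans le_top (le_trans (le_of_eq ?_) (ENNReal.le_tsum i))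
    exact (extend_eq_top _ hi).symm
  have hle : ∀ B : Set U, IsOpen B → V.variationOuter B ≤ V.variationOn B := by
    intro B hB
    rw [variationOuter, inducedOuterMeasure]
    refine (OuterMeasure.ofFunction_le B).trans ?_
    rw [extend_eq _ hB]
  have hcov : ∀ {u W : Set U}, u ⊆ s ∪ t → u ⊆ W → IsOpen W →
      V.variationOuter u ≤ ∑' i, V.variationOn (A i ∩ W) := by
    intro u W hu huW hW
    refine (measure_mono (t := ⋃ i, A i ∩ W) ?_).trans ((measure_iUnion_le _).trans
      (ENNReal.tsum_le_tsum fun i => hle _ ((hAo i).inter hW)))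
    rw [← Set.iUnion_inter]
    exact Set.subset_inter (hu.trans hA) huW
  refine (add_le_add (hcov Set.subset_union_left hsS hSo)
    (hcov Set.subset_union_right htT hTo)).trans ?_
  rw [← ENNReal.tsum_add]
  refine ENNReal.tsum_le_tsum fun i => ?_
  rw [extend_eq _ (hAo i)]
  exact V.variationOn_add_le
    (hdisj.mono Set.inter_subset_right Set.inter_subset_right)
    Set.inter_subset_left Set.inter_subset_left

/-- The total variation measure `‖δV‖` of the first variation: the largest Borel measure over `U`
with `‖δV‖(A) = sup {δV(θ) : spt θ ⊆ A, |θ| ≤ 1}` for all open `A`. It is a Radon measure if and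
only if it is finite on compact sets. -/
def variation (V : Varifold m U) : Measure U :=
  V.variationOuter.toMeasure
    (by
      rw [BorelSpace.measurable_eq (α := U)]
      exact V.variationOuter_isMetric.borel_le_caratheodory)

/-- The neighbourhoods of a vector field `η` on `U`, in the `‖δV‖`-seminorm of order `1`, among
the test vector fields. -/
def testNhds (V : Varifold m U) (η : U → Rn n) : Filter 𝓓(U, Rn n) :=
  comap (fun θ : 𝓓(U, Rn n) => eLpNorm (fun x : U => θ x - η x) 1 V.variation) (𝓝 0)

/-- The value `(δV)(η)`, at `η ∈ L₁(‖δV‖, ℝⁿ)`, of the unique `‖δV‖`-seminorm continuous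
extension of `δV` to `L₁(‖δV‖, ℝⁿ)` (for Radon `‖δV‖`): the limit of `δV(θ)` as `θ ∈ 𝓓(U, ℝⁿ)`
approaches `η` in that seminorm. -/
def firstVariationExt (V : Varifold m U) (η : U → Rn n) : ℝ :=
  limUnder (V.testNhds η) V.firstVariation

/-! ### Generalised weakly differentiable functions -/

variable {Y : Type*} [NormedAddCommGroup Y] [NormedSpace ℝ Y]

/-- `F` is (a representative of) the generalised `V` weak derivative `V 𝐃f` of `f`. Functions
defined almost everywhere are represented by functions on all of `U`; only their almost everywhere
equivalence classes matter, for `‖V‖ + ‖δV‖` in the case of `f` and for `‖V‖` in the case of `F`. -/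
structure IsWeakDeriv (V : Varifold m U) (f : U → Y) (F : U → (Rn n →L[ℝ] Y)) : Prop where
  measurable_fun : AEStronglyMeasurable f (V.weight + V.variation)
  measurable_deriv : AEStronglyMeasurable F V.weight
  integral_lt_top : ∀ (K : Set U), IsCompact K → ∀ s : ℝ, 0 ≤ s →
    ∫⁻ x in K ∩ {x | ‖f x‖ ≤ s}, ‖F x‖ₑ ∂V.weight < ∞
  firstVariation_eq : ∀ (θ : 𝓓(U, Rn n)) (γ : Y → ℝ), ContDiff ℝ (⊤ : ℕ∞) γ →
    HasCompactSupport (fderiv ℝ γ) →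
    V.firstVariationExt (fun x => γ (f x) • θ x) =
      ∫ z : U × Grass n m,
        (γ (f z.1) * z.2.dot (fderiv ℝ θ z.1) + fderiv ℝ γ (f z.1) (F z.1 (θ z.1))) ∂V.measure

/-- `f ∈ 𝐓(V,Y)`: the function `f` is generalised `V` weakly differentiable. -/
def IsWeaklyDiff (V : Varifold m U) (f : U → Y) : Prop :=
  ∃ F : U → (Rn n →L[ℝ] Y), V.IsWeakDeriv f F

end Varifold

/-- `Lip (f | s)`: the smallest Lipschitz constant of `f` on `s`, possibly `∞`. -/
def lipConst {X Y : Type*} [PseudoEMetricSpace X] [PseudoEMetricSpace Y] (f : X → Y)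
    (s : Set X) : ℝ≥0∞ :=
  ⨅ (K : ℝ≥0) (_ : LipschitzOnWith K f s), (K : ℝ≥0∞)

end

noncomputable section

/-! ### Test functions -/

/-! For a continuous function `g` on `U` consider the functional `T_g(θ) = δV(gθ) - ∫ g(x) P♮ •
Dθ(x) dV(x,P)`, which is `derivFunctional`. Three properties carry everything. It is local: only `g`
on the support of `θ` matters. It is continuous under locally uniform convergence of `g`, since
`|δV(θ)| ≤ 2 ∫ |θ| d‖δV‖`. If `g` is the restriction of a smooth `G`, the product rule gives `T_g(θ)
= ∫ ⟨P♮ θ, DG⟩ dV`, so projections being contractions yields `|T_g(φv)| ≤ Lip(G) |v| ∫ |φ| d‖V‖`.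

Mollification does not increase Lipschitz constants, so the last bound survives for Lipschitzian
`g`. Applied to `l ∘ f` with `l` linear, it lets the Riesz representation theorem produce `F` with
`T_{l∘f}(θ) = ∫ l(F(θ)) d‖V‖` (`exists_locallyIntegrable_deriv`). Testing on small open sets bounds
`‖F‖` by the local Lipschitz constant.

It remains to pass from linear `l` to smooth `γ`. Smooth approximations `g_i` satisfy the chain rule
with the plane-dependent derivative `D_i(x,P) = Dg_i(x) ∘ P♮`. The `D_i` are uniformly bounded and,
against coefficients depending on `x` alone, converge weakly to `F`, while `Dγ(g_i)` converges
uniformly on the support of `θ`; hence the products converge (`hasChainRule_of_tendsto`). Locality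
reduces locally Lipschitzian functions to Lipschitzian ones on `ℝⁿ`.

The second statement is the same limit theorem with `D_i = V 𝐃f_i`: the bound `κ` passes to the
limit functional, yields the density by Riesz, and the weak convergence is the asserted one. -/

instance Opens.instLocallyCompactSpaceRn {n : ℕ} (U : Opens (Rn n)) : LocallyCompactSpace U :=
  U.isOpen.locallyCompactSpace

namespace TestFunction

variable {n : ℕ} {U : Opens (Rn n)} {E : Type*} [NormedAddCommGroup E] [NormedSpace ℝ E]

/-- The product of a smooth scalar function with a test function. -/
def smoothSmul (g : Rn n → ℝ) (hg : ContDiff ℝ (⊤ : ℕ∞) g) (θ : 𝓓(U, E)) : 𝓓(U, E) where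
  toFun x := g x • θ x
  contDiff' := hg.smul θ.contDiff
  hasCompactSupport' := θ.hasCompactSupport.smul_left
  tsupport_subset' := (tsupport_smul_subset_right g θ).trans θ.tsupport_subset

@[simp] theorem smoothSmul_apply (g : Rn n → ℝ) (hg : ContDiff ℝ (⊤ : ℕ∞) g) (θ : 𝓓(U, E))
    (x : Rn n) : smoothSmul g hg θ x = g x • θ x := rfl

theorem tsupport_smoothSmul_subset_left (g : Rn n → ℝ) (hg : ContDiff ℝ (⊤ : ℕ∞) g)
    (θ : 𝓓(U, E)) : tsupport (smoothSmul g hg θ) ⊆ tsupport g :=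
  tsupport_smul_subset_left g θ

theorem tsupport_smoothSmul_subset_right (g : Rn n → ℝ) (hg : ContDiff ℝ (⊤ : ℕ∞) g)
    (θ : 𝓓(U, E)) : tsupport (smoothSmul g hg θ) ⊆ tsupport θ :=
  tsupport_smul_subset_right g θ

/-- Multiplication of test functions by a smooth scalar function, as a linear map. -/
def smoothSmulₗ (g : Rn n → ℝ) (hg : ContDiff ℝ (⊤ : ℕ∞) g) : 𝓓(U, E) →ₗ[ℝ] 𝓓(U, E) where
  toFun := smoothSmul g hg
  map_add' θ η := by ext x; simp [smul_add]
  map_smul' c θ := by ext x; exact smul_comm _ _ _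

@[simp] theorem smoothSmulₗ_apply (g : Rn n → ℝ) (hg : ContDiff ℝ (⊤ : ℕ∞) g) (θ : 𝓓(U, E)) :
    smoothSmulₗ g hg θ = smoothSmul g hg θ := rfl

/-- The test function `x ↦ φ x • v`, as a linear map in `φ`. -/
def smulVec (v : E) : 𝓓(U, ℝ) →ₗ[ℝ] 𝓓(U, E) where
  toFun φ :=
    { toFun := fun x => φ x • v
      contDiff' := φ.contDiff.smul contDiff_const
      hasCompactSupport' := φ.hasCompactSupport.smul_right
      tsupport_subset' := (tsupport_smul_subset_left φ fun _ => v).trans φ.tsupport_subset }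
  map_add' φ ψ := by ext x; simp [add_smul]
  map_smul' c φ := by ext x; simp [mul_smul]

@[simp] theorem smulVec_apply (v : E) (φ : 𝓓(U, ℝ)) (x : Rn n) : smulVec v φ x = φ x • v := rfl

theorem tsupport_smulVec_subset (v : E) (φ : 𝓓(U, ℝ)) : tsupport (smulVec v φ) ⊆ tsupport φ :=
  tsupport_smul_subset_left φ fun _ => v

/-- The preimage in `U` of the support of a test function is compact. -/
theorem isCompact_preimage_tsupport (θ : 𝓓(U, E)) : IsCompact ((↑) ⁻¹' tsupport θ : Set U) :=
  Topology.IsInducing.subtypeVal.isCompact_preimage' θ.hasCompactSupport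
    (by simpa using θ.tsupport_subset)

theorem eq_zero_of_notMem (θ : 𝓓(U, E)) {x : U} (hx : x ∉ ((↑) ⁻¹' tsupport θ : Set U)) :
    θ x = 0 :=
  image_eq_zero_of_notMem_tsupport hx

theorem fderiv_eq_zero_of_notMem (θ : 𝓓(U, E)) {x : U}
    (hx : x ∉ ((↑) ⁻¹' tsupport θ : Set U)) : fderiv ℝ θ (x : Rn n) = 0 :=
  image_eq_zero_of_notMem_tsupport fun h => hx (tsupport_fderiv_subset ℝ h)

theorem hasCompactSupport_restrict (θ : 𝓓(U, E)) : HasCompactSupport fun x : U => θ x :=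
  HasCompactSupport.intro θ.isCompact_preimage_tsupport fun _ hx => θ.eq_zero_of_notMem hx

theorem continuous_restrict (θ : 𝓓(U, E)) : Continuous fun x : U => θ x :=
  θ.continuous.comp continuous_subtype_val

theorem memLp_restrict (θ : 𝓓(U, E)) (μ : Measure U) [IsFiniteMeasureOnCompacts μ] (p : ℝ≥0∞) :
    MemLp (fun x : U => θ x) p μ :=
  θ.continuous_restrict.memLp_of_hasCompactSupport θ.hasCompactSupport_restrict

theorem integrable_restrict (θ : 𝓓(U, E)) (μ : Measure U) [IsFiniteMeasureOnCompacts μ] :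
    Integrable (fun x : U => θ x) μ :=
  θ.continuous_restrict.integrable_of_hasCompactSupport θ.hasCompactSupport_restrict

theorem integrable_smul_of_locallyIntegrable (φ : 𝓓(U, ℝ)) {μ : Measure U} {h : U → E}
    (hh : LocallyIntegrable h μ) : Integrable (fun x : U => φ x • h x) μ :=
  hh.integrable_smul_left_of_hasCompactSupport φ.continuous_restrict φ.hasCompactSupport_restrict

/-- Smooth cutoff functions. -/
theorem exists_cutoff {K W : Set U} (hK : IsCompact K) (hW : IsOpen W) (hKW : K ⊆ W) :
    ∃ χ : 𝓓(U, ℝ), (∀ x, 0 ≤ χ x ∧ χ x ≤ 1) ∧ (∀ x ∈ K, χ x = 1) ∧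
      ((↑) ⁻¹' tsupport χ : Set U) ⊆ W := by
  obtain ⟨L, hL, hKL, hLW⟩ := exists_compact_between hK hW hKW
  have hKc : IsCompact ((↑) '' K : Set (Rn n)) := hK.image continuous_subtype_val
  have hLc : IsCompact ((↑) '' L : Set (Rn n)) := hL.image continuous_subtype_val
  have hLo : IsOpen ((↑) '' interior L : Set (Rn n)) :=
    U.isOpen.isOpenMap_subtype_val _ isOpen_interior
  obtain ⟨f, hf, hr, hs, h1⟩ := exists_contMDiff_support_eq_eq_one_iff (n := ⊤)
    (modelWithCornersSelf ℝ (Rn n)) hLo hKc.isClosed (Set.image_mono hKL)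
  have ht : tsupport f ⊆ ((↑) '' L : Set (Rn n)) := by
    refine closure_minimal ?_ hLc.isClosed
    rw [hs]
    exact Set.image_mono interior_subset
  refine ⟨⟨f, hf.contDiff, HasCompactSupport.of_support_subset_isCompact hLc
    (subset_closure.trans ht), ht.trans ?_⟩, fun x => hr ⟨x, rfl⟩, fun x hx => ?_, ?_⟩
  · rintro _ ⟨x, -, rfl⟩
    exact x.2
  · exact (h1 x).1 ⟨x, hx, rfl⟩
  · intro x hx
    obtain ⟨y, hy, hyx⟩ := ht hx
    exact hLW (Subtype.ext hyx ▸ hy)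

/-- Test functions are dense in `L_p`, for `p < ∞`. -/
theorem exists_eLpNorm_sub_le {μ : Measure U} [IsFiniteMeasureOnCompacts μ] {p : ℝ≥0∞}
    (hp : p ≠ ∞) (hp1 : 1 ≤ p) {f : U → E} (hf : MemLp f p μ) {ε : ℝ≥0∞} (hε : ε ≠ 0) :
    ∃ θ : 𝓓(U, E), eLpNorm (fun x : U => f x - θ x) p μ ≤ ε := by
  have hε2 : ε / 2 ≠ 0 := by simpa using hε
  obtain ⟨g, hgc, hfg, hg, hgm⟩ := hf.exists_hasCompactSupport_eLpNorm_sub_le hp hε2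
  set K := tsupport g
  have hμK : μ K ≠ ∞ := hgc.measure_lt_top.ne
  -- The extension by zero is continuous because `g` has compact support in the open set `U`;
  -- smoothing then takes place on all of `ℝⁿ`.
  set g' : Rn n → E := Function.extend (↑) g 0 with hg'
  have hg'c : Continuous g' := HasCompactSupport.continuous_extend_zero U.isOpen hg hgc
  have hg't : tsupport g' = (↑) '' K :=
    HasCompactSupport.tsupport_extend_zero hgc continuous_subtype_val Subtype.val_injective
  have hg'e : ∀ x : U, g' x = g x := fun x => Subtype.val_injective.extend_apply g 0 x
  -- A uniform error `δ` supported in `K` costs at most `δ μ(K)^(1/p)` in `L_p`; the smooth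
  -- approximant below keeps its support inside that of `g`, so `K` need not be enlarged.
  obtain ⟨δ, hδ, hδε⟩ : ∃ δ : ℝ, 0 < δ ∧ ENNReal.ofReal δ * μ K ^ (1 / p.toReal) ≤ ε / 2 := by
    have hM : μ K ^ (1 / p.toReal) ≠ ∞ := ENNReal.rpow_ne_top_of_nonneg (by positivity) hμK
    rcases eq_or_ne ε ∞ with rfl | hεt
    · exact ⟨1, one_pos, by rw [ENNReal.top_div_of_ne_top (by simp)]; exact le_top⟩
    · set M := μ K ^ (1 / p.toReal)
      refine ⟨(ε / 2).toReal / (M.toReal + 1), ?_, ?_⟩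
      · have : 0 < (ε / 2).toReal := ENNReal.toReal_pos hε2 (ENNReal.div_ne_top hεt (by simp))
        positivity
      · rw [← ENNReal.ofReal_toReal hM, ← ENNReal.ofReal_mul (by positivity)]
        refine ENNReal.ofReal_le_of_le_toReal ?_
        rw [ENNReal.toReal_ofReal (by positivity)]
        rw [div_mul_eq_mul_div, div_le_iff₀ (by positivity)]
        gcongr
        linarith
  obtain ⟨k, hk, hkg, hks⟩ := hg'c.exists_contDiff_approx ⊤ (ε := fun _ => δ) continuous_const
    fun _ => hδ
  have hkt : tsupport k ⊆ (↑) '' K := hg't ▸ closure_mono hks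
  have hKc : IsCompact ((↑) '' K : Set (Rn n)) := hgc.isCompact.image continuous_subtype_val
  refine ⟨⟨k, hk, HasCompactSupport.of_support_subset_isCompact hKc
    (subset_closure.trans hkt), hkt.trans ?_⟩, ?_⟩
  · rintro _ ⟨x, -, rfl⟩
    exact x.2
  · have h2 : eLpNorm (g - fun x : U => k x) p μ ≤ ε / 2 := by
      refine (eLpNorm_sub_le_of_dist_bdd μ hp hgc.measurableSet hδ.le (fun x => ?_)
        (subset_tsupport g) (fun x hx => ?_)).trans hδε
      · rw [dist_comm, ← hg'e]
        exact (hkg x).le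
      · obtain ⟨y, hy, hyx⟩ := hkt (subset_tsupport k hx)
        exact Subtype.ext hyx ▸ hy
    have hkm : AEStronglyMeasurable (fun x : U => k x) μ :=
      (hk.continuous.comp continuous_subtype_val).aestronglyMeasurable
    have : (fun x : U => f x - k x) = (f - g) + (g - fun x : U => k x) := by
      ext x; simp
    calc eLpNorm (fun x : U => f x - k x) p μ
        = eLpNorm ((f - g) + (g - fun x : U => k x)) p μ := by rw [this]
      _ ≤ ε / 2 + ε / 2 := (eLpNorm_add_le (hf.1.sub hgm.1) (hgm.1.sub hkm) hp1).trans
          (add_le_add hfg h2)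
      _ = ε := ENNReal.add_halves ε

end TestFunction

/-! ### Bounds for locally integrable functions in terms of test functions -/

namespace TestFunction

variable {n : ℕ} {U : Opens (Rn n)}

/-- The indicator function of a compact set is a limit of cutoff functions. -/
theorem exists_seq_cutoff (μ : Measure U) {K W : Set U} (hK : IsCompact K) (hW : IsOpen W) (hKW : K ⊆ W) :
    ∃ χ : ℕ → 𝓓(U, ℝ), (∀ i x, 0 ≤ χ i x) ∧ (∀ i, ((↑) ⁻¹' tsupport (χ i) : Set U) ⊆ W) ∧
      ∀ h : U → ℝ, LocallyIntegrable h μ →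
        Tendsto (fun i => ∫ x, χ i x * h x ∂μ) atTop (𝓝 (∫ x in K, h x ∂μ)) := by
  obtain ⟨L, hL, hKL, hLW⟩ := exists_compact_between hK hW hKW
  -- Cutoffs supported in neighbourhoods shrinking to `K` converge pointwise to its indicator; the
  -- fixed compact set `L` supplies the integrable majorant.
  have hV : ∀ i : ℕ, IsOpen (Metric.thickening (1 / (i + 1 : ℝ)) K ∩ interior L) := fun i =>
    Metric.isOpen_thickening.inter isOpen_interior
  have hKV : ∀ i : ℕ, K ⊆ Metric.thickening (1 / (i + 1 : ℝ)) K ∩ interior L := fun i =>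
    Set.subset_inter (Metric.self_subset_thickening (by positivity) K) hKL
  choose χ hχ01 hχ1 hχs using fun i => exists_cutoff hK (hV i) (hKV i)
  refine ⟨χ, fun i x => (hχ01 i x).1, fun i => (hχs i).trans
    (Set.inter_subset_right.trans (interior_subset.trans hLW)), fun h hh => ?_⟩
  rw [← integral_indicator hK.measurableSet]
  have hzero : ∀ (i : ℕ) x, x ∉ Metric.thickening (1 / (i + 1 : ℝ)) K ∩ interior L → χ i x = 0 :=
    fun i x hx => (χ i).eq_zero_of_notMem fun h => hx (hχs i h)
  refine tendsto_integral_of_dominated_convergence (L.indicator fun x => ‖h x‖)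
    (fun i => (χ i).continuous_restrict.aestronglyMeasurable.mul hh.aestronglyMeasurable) ?_
    (fun i => Eventually.of_forall fun x => ?_) (Eventually.of_forall fun x => ?_)
  · rw [integrable_indicator_iff hL.measurableSet]
    exact (hh.integrableOn_isCompact hL).norm
  · by_cases hx : x ∈ L
    · rw [Set.indicator_of_mem hx, norm_mul, Real.norm_of_nonneg (hχ01 i x).1]
      exact mul_le_of_le_one_left (norm_nonneg _) (hχ01 i x).2
    · rw [hzero i x fun hx' => hx (interior_subset hx'.2)]
      simp [hx]
  · by_cases hx : x ∈ K
    · simp [hx, hχ1 _ x hx]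
    · rw [Set.indicator_of_notMem hx]
      refine tendsto_const_nhds.congr' ?_
      obtain ⟨ε, hε, hxε⟩ : ∃ ε, 0 < ε ∧ x ∉ Metric.thickening ε K := by
        rw [← hK.isClosed.closure_eq, Metric.closure_eq_iInter_thickening] at hx
        simpa using hx
      filter_upwards [(tendsto_order.1 (tendsto_one_div_add_atTop_nhds_zero_nat (𝕜 := ℝ))).2 ε hε]
        with i hi
      rw [hzero i x fun hx' => hxε (Metric.thickening_mono hi.le K hx'.1), zero_mul]

variable {μ : Measure U} [IsFiniteMeasureOnCompacts μ]

/-- Cutoffs turn the hypothesis into an inequality of integrals over compact subsets of `W`. If `h >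
L` on a part of `W` of positive measure, inner regularity finds a compact set there of positive
measure, a contradiction. -/
theorem ae_le_of_integral_le {W : Set U} (hW : IsOpen W) {h : U → ℝ} (hh : LocallyIntegrable h μ)
    {L : ℝ} (hb : ∀ φ : 𝓓(U, ℝ), ((↑) ⁻¹' tsupport φ : Set U) ⊆ W →
      ∫ x : U, φ x * h x ∂μ ≤ L * ∫ x : U, |φ x| ∂μ) :
    ∀ᵐ x ∂μ, x ∈ W → h x ≤ L := by
  have hKb : ∀ K ⊆ W, IsCompact K → ∫ x in K, h x ∂μ ≤ ∫ _ in K, L ∂μ := by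
    intro K hKW hK
    obtain ⟨χ, h0, hs, hl⟩ := exists_seq_cutoff μ hK hW hKW
    refine le_of_tendsto_of_tendsto' (hl h hh) (hl (fun _ => L) (locallyIntegrable_const L))
      fun i => ?_
    rw [integral_mul_const, mul_comm]
    simpa only [abs_of_nonneg (h0 i _)] using hb (χ i) (hs i)
  set h' := hh.aestronglyMeasurable.mk h with hh'
  have hae : h =ᵐ[μ] h' := hh.aestronglyMeasurable.ae_eq_mk
  have hm : Measurable h' := hh.aestronglyMeasurable.stronglyMeasurable_mk.measurable
  set A : Set U := W ∩ {x | L < h' x} with hA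
  have hAm : MeasurableSet A := hW.measurableSet.inter (measurableSet_lt measurable_const hm)
  have hA0 : μ A = 0 := by
    by_contra hne
    obtain ⟨K, hKA, hK, hμK⟩ := hAm.exists_lt_isCompact (pos_iff_ne_zero.2 hne)
    have hint : IntegrableOn h K μ := hh.integrableOn_isCompact hK
    have hintc : IntegrableOn (fun _ => L) K μ :=
      (locallyIntegrable_const L).integrableOn_isCompact hK
    have h1 := hKb K (hKA.trans Set.inter_subset_left) hK
    have h2 : ∀ᵐ x ∂μ.restrict K, L < h x := by
      rw [ae_restrict_iff' hK.measurableSet]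
      filter_upwards [hae] with x hx hxK
      rw [hx]
      exact (hKA hxK).2
    have h3 : ∫ x in K, (h x - L) ∂μ = 0 := by
      refine le_antisymm ?_ (integral_nonneg_of_ae (h2.mono fun x hx => (sub_pos.2 hx).le))
      rw [integral_sub hint hintc]
      linarith
    rw [integral_eq_zero_iff_of_nonneg_ae (h2.mono fun x hx => (sub_pos.2 hx).le)
      (hint.sub hintc)] at h3
    have h4 : ∀ᵐ x ∂μ.restrict K, False := by
      filter_upwards [h2, h3] with x hx hx'
      exact (sub_pos.2 hx).ne' hx'
    rw [eventually_false_iff_eq_bot, ae_eq_bot, Measure.restrict_eq_zero] at h4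
    exact hμK.ne' h4
  filter_upwards [measure_eq_zero_iff_ae_notMem.1 hA0, hae] with x hx hx' hxW
  rw [hx']
  exact not_lt.1 fun hlt => hx ⟨hxW, hlt⟩

theorem ae_eq_of_integral_eq {W : Set U} (hW : IsOpen W) {h h' : U → ℝ}
    (hh : LocallyIntegrable h μ) (hh' : LocallyIntegrable h' μ)
    (he : ∀ φ : 𝓓(U, ℝ), ((↑) ⁻¹' tsupport φ : Set U) ⊆ W →
      ∫ x : U, φ x * h x ∂μ = ∫ x : U, φ x * h' x ∂μ) :
    ∀ᵐ x ∂μ, x ∈ W → h x = h' x := by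
  have hi : ∀ φ : 𝓓(U, ℝ), ∫ x : U, φ x * (h x - h' x) ∂μ =
      ∫ x : U, φ x * h x ∂μ - ∫ x : U, φ x * h' x ∂μ := by
    intro φ
    simp_rw [mul_sub]
    exact integral_sub (φ.integrable_smul_of_locallyIntegrable hh)
      (φ.integrable_smul_of_locallyIntegrable hh')
  have hi' : ∀ φ : 𝓓(U, ℝ), ∫ x : U, φ x * (h' x - h x) ∂μ =
      ∫ x : U, φ x * h' x ∂μ - ∫ x : U, φ x * h x ∂μ := by
    intro φ
    simp_rw [mul_sub]
    exact integral_sub (φ.integrable_smul_of_locallyIntegrable hh')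
      (φ.integrable_smul_of_locallyIntegrable hh)
  filter_upwards [ae_le_of_integral_le hW (L := 0) (hh.sub hh') fun φ hφ => by
      simp [hi φ, he φ hφ], ae_le_of_integral_le hW (L := 0) (hh'.sub hh) fun φ hφ => by
      simp [hi' φ, he φ hφ]] with x h1 h2 hx
  have h1' := h1 hx
  have h2' := h2 hx
  simp only [Pi.sub_apply] at h1' h2'
  linarith

/-- The scalar bound holds off a null set depending on `l` and `v`. Countable dense families of both
give one null set, continuity extends the bound to all pairs, and duality recovers the operator
norm. -/
theorem ae_opNorm_le_of_integral_le {Y : Type*} [NormedAddCommGroup Y] [NormedSpace ℝ Y]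
    [FiniteDimensional ℝ Y] {W : Set U} (hW : IsOpen W) {F : U → (Rn n →L[ℝ] Y)}
    (hF : LocallyIntegrable F μ) {L : ℝ} (hL : 0 ≤ L)
    (hb : ∀ (φ : 𝓓(U, ℝ)) (l : Y →L[ℝ] ℝ) (v : Rn n), ((↑) ⁻¹' tsupport φ : Set U) ⊆ W →
      |∫ x : U, φ x * l (F x v) ∂μ| ≤ L * ‖l‖ * ‖v‖ * ∫ x : U, |φ x| ∂μ) :
    ∀ᵐ x ∂μ, x ∈ W → ‖F x‖ ≤ L := by
  have hFl : ∀ (l : Y →L[ℝ] ℝ) (v : Rn n), LocallyIntegrable (fun x => l (F x v)) μ := by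
    intro l v x
    obtain ⟨s, hs, hi⟩ := hF x
    exact ⟨s, hs, (l.comp (ContinuousLinearMap.apply ℝ Y v)).integrable_comp hi⟩
  have hlv : ∀ (l : Y →L[ℝ] ℝ) (v : Rn n), ∀ᵐ x ∂μ, x ∈ W → l (F x v) ≤ L * ‖l‖ * ‖v‖ :=
    fun l v => ae_le_of_integral_le hW (hFl l v) fun φ hφ =>
      (le_abs_self _).trans (hb φ l v hφ)
  have : ProperSpace (Y →L[ℝ] ℝ) := FiniteDimensional.proper_real _
  have hall : ∀ᵐ x ∂μ, ∀ i j : ℕ, x ∈ W → (denseSeq (Y →L[ℝ] ℝ) i) (F x (denseSeq (Rn n) j)) ≤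
      L * ‖denseSeq (Y →L[ℝ] ℝ) i‖ * ‖denseSeq (Rn n) j‖ :=
    ae_all_iff.2 fun i => ae_all_iff.2 fun j => hlv _ _
  filter_upwards [hall] with x hx hxW
  have hd : ∀ p : (Y →L[ℝ] ℝ) × Rn n, p.1 (F x p.2) ≤ L * ‖p.1‖ * ‖p.2‖ := by
    intro p
    refine ((denseRange_denseSeq (Y →L[ℝ] ℝ)).prodMap (denseRange_denseSeq (Rn n))).induction_on
      (p := fun p => p.1 (F x p.2) ≤ L * ‖p.1‖ * ‖p.2‖) p ?_ fun ij => hx ij.1 ij.2 hxW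
    refine isClosed_le ?_ (by fun_prop)
    exact continuous_fst.clm_apply ((F x).continuous.comp continuous_snd)
  refine ContinuousLinearMap.opNorm_le_bound _ hL fun v => ?_
  refine NormedSpace.norm_le_dual_bound ℝ _ (by positivity) fun l => ?_
  rw [Real.norm_eq_abs, abs_le]
  have h1 := hd (l, v)
  have h2 := hd (-l, v)
  simp only [neg_apply, norm_neg] at h1 h2
  constructor <;> nlinarith

/-! ### Representation of functionals on test functions -/

/-- A functional bounded by the `L₁` norm of a finite measure has a density. -/
theorem exists_memLp_repr_of_isFiniteMeasure [IsFiniteMeasure μ] (S : 𝓓(U, ℝ) →ₗ[ℝ] ℝ) {C : ℝ}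
    (hC : 0 ≤ C) (hS : ∀ φ, |S φ| ≤ C * ∫ x : U, |φ x| ∂μ) :
    ∃ h : U → ℝ, Integrable h μ ∧ ∀ φ, S φ = ∫ x : U, φ x * h x ∂μ := by
  let e : 𝓓(U, ℝ) →ₗ[ℝ] Lp ℝ 2 μ :=
    { toFun := fun φ => (φ.memLp_restrict μ 2).toLp
      map_add' := fun φ ψ => rfl
      map_smul' := fun c φ => rfl }
  have he : ∀ φ, e φ =ᵐ[μ] fun x : U => φ x := fun φ => (φ.memLp_restrict μ 2).coeFn_toLp
  have hd : DenseRange e := by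
    intro f
    refine EMetric.mem_closure_iff.2 fun ε hε => ?_
    obtain ⟨φ, hφ⟩ := exists_eLpNorm_sub_le (by simp) (by simp) (Lp.memLp f)
      (ENNReal.half_pos hε.ne').ne'
    rcases eq_or_ne ε ∞ with rfl | hεt
    · exact ⟨_, ⟨φ, rfl⟩, edist_lt_top _ _⟩
    refine ⟨_, ⟨φ, rfl⟩, lt_of_le_of_lt ?_ (ENNReal.half_lt_self hε.ne' hεt)⟩
    rw [Lp.edist_def]
    refine le_trans (le_of_eq (eLpNorm_congr_ae ?_)) hφ
    filter_upwards [he φ] with x hx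
    simp [hx]
  -- Since `μ` is finite, the `L₁` bound implies an `L₂` bound, so Riesz representation in the
  -- Hilbert space `L₂` suffices. An essential bound on the density is recovered separately from the
  -- `L₁` estimate.
  have hb : ∀ φ, ‖S φ‖ ≤ C * ((μ Set.univ) ^ (1 / 2 : ℝ)).toReal * ‖e φ‖ := by
    intro φ
    refine (hS φ).trans ?_
    rw [mul_assoc]
    gcongr
    have h1 : ∫ x : U, |φ x| ∂μ = (eLpNorm (fun x : U => φ x) 1 μ).toReal := by
      rw [eLpNorm_one_eq_lintegral_enorm,
        ← integral_norm_eq_lintegral_enorm (φ.integrable_restrict μ).1]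
      rfl
    rw [h1, Lp.norm_def, eLpNorm_congr_ae (he φ), ← ENNReal.toReal_mul]
    refine ENNReal.toReal_mono (ENNReal.mul_ne_top (by simp) (φ.memLp_restrict μ 2).2.ne) ?_
    have := eLpNorm_le_eLpNorm_mul_rpow_measure_univ (p := 1) (q := 2) (by norm_num)
      (φ.integrable_restrict μ).1
    rw [mul_comm]
    convert this using 3
    norm_num
  set Λ := S.extendOfNorm e
  have hΛ : ∀ φ, Λ (e φ) = S φ := fun φ => LinearMap.extendOfNorm_eq hd ⟨_, hb⟩ φ
  set h : Lp ℝ 2 μ := (InnerProductSpace.toDual ℝ (Lp ℝ 2 μ)).symm Λ with hh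
  refine ⟨h, (Lp.memLp h).integrable (by norm_num), fun φ => ?_⟩
  rw [← hΛ, ← InnerProductSpace.toDual_symm_apply, L2.inner_def]
  refine integral_congr_ae ?_
  filter_upwards [he φ] with x hx
  rw [hx]
  simp [hh]

end TestFunction

namespace TestFunction

variable {n : ℕ} {U : Opens (Rn n)} {μ : Measure U} [IsFiniteMeasureOnCompacts μ]

/-- A functional which is locally bounded by the `L₁` norm has a locally integrable density. -/
theorem exists_locallyIntegrable_repr (S : 𝓓(U, ℝ) →ₗ[ℝ] ℝ)
    (hS : ∀ K : Set U, IsCompact K → ∃ C, 0 ≤ C ∧ ∀ φ : 𝓓(U, ℝ),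
      ((↑) ⁻¹' tsupport φ : Set U) ⊆ K → |S φ| ≤ C * ∫ x : U, |φ x| ∂μ) :
    ∃ h : U → ℝ, LocallyIntegrable h μ ∧ ∀ φ, S φ = ∫ x : U, φ x * h x ∂μ := by
  set K : CompactExhaustion U := CompactExhaustion.choice U
  have step : ∀ j, ∃ H : U → ℝ, Integrable H μ ∧ ∀ φ : 𝓓(U, ℝ),
      ((↑) ⁻¹' tsupport φ : Set U) ⊆ K j → S φ = ∫ x : U, φ x * H x ∂μ := by
    intro j
    obtain ⟨χ, hχ01, hχ1, -⟩ := exists_cutoff (K.isCompact j) isOpen_univ (Set.subset_univ _)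
    set L : Set U := (↑) ⁻¹' tsupport χ
    have hL : IsCompact L := χ.isCompact_preimage_tsupport
    obtain ⟨C, hC, hSC⟩ := hS L hL
    have : IsFiniteMeasure (μ.restrict L) := isFiniteMeasure_restrict.2 hL.measure_lt_top.ne
    obtain ⟨h, hh, hrep⟩ := exists_memLp_repr_of_isFiniteMeasure (μ := μ.restrict L)
      (S ∘ₗ smoothSmulₗ χ χ.contDiff) hC fun φ => by
        refine (hSC _ fun x hx => tsupport_smoothSmul_subset_left χ χ.contDiff φ hx).trans ?_
        gcongr
        rw [← integral_indicator hL.measurableSet]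
        refine integral_mono ((smoothSmul χ χ.contDiff φ).integrable_restrict μ).abs
          ((φ.integrable_restrict μ).abs.indicator hL.measurableSet) fun x => ?_
        by_cases hx : x ∈ L
        · simp only [Set.indicator_of_mem hx, smoothSmul_apply, smul_eq_mul, abs_mul]
          rw [abs_of_nonneg (hχ01 x).1]
          exact mul_le_of_le_one_left (abs_nonneg _) (hχ01 x).2
        · simp [χ.eq_zero_of_notMem hx, hx]
    refine ⟨L.indicator h, (integrable_indicator_iff hL.measurableSet).2 hh, fun φ hφ => ?_⟩
    have h1 : smoothSmul χ χ.contDiff φ = φ := by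
      ext x
      by_cases hx : x ∈ tsupport φ
      · have := hχ1 ⟨x, φ.tsupport_subset hx⟩ (hφ hx)
        simp [this]
      · simp [image_eq_zero_of_notMem_tsupport hx]
    have h2 := hrep φ
    rw [LinearMap.comp_apply, smoothSmulₗ_apply, h1] at h2
    rw [h2, ← integral_indicator hL.measurableSet]
    congr 1
    ext x
    by_cases hx : x ∈ L <;> simp [hx]
  -- The densities of two stages are compared only on interiors, where test functions separate them
  -- almost everywhere.
  choose H hHi hH using step
  have hcons : ∀ᵐ x ∂μ, ∀ i j, i ≤ j → x ∈ interior (K i) → H i x = H j x := by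
    refine ae_all_iff.2 fun i => ae_all_iff.2 fun j => ?_
    by_cases hij : i ≤ j
    · filter_upwards [ae_eq_of_integral_eq isOpen_interior (hHi i).locallyIntegrable
        (hHi j).locallyIntegrable fun φ hφ => by
          rw [← hH i φ (hφ.trans interior_subset),
            ← hH j φ ((hφ.trans interior_subset).trans (K.subset hij))]] with x hx _ using hx
    · exact Eventually.of_forall fun x h => absurd h hij
  have hHK : ∀ᵐ x ∂μ, ∀ i, x ∈ interior (K i) → H (K.find x + 1) x = H i x := by
    filter_upwards [hcons] with x hx i hi
    have hf : x ∈ interior (K (K.find x + 1)) := K.subset_interior_succ _ (K.mem_find x)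
    rcases le_total i (K.find x + 1) with h | h
    · exact (hx i _ h hi).symm
    · exact hx _ _ h hf
  -- The shift by one puts `x`, a point of the set with index `K.find x`, into the interior of the
  -- next set of the exhaustion.
  refine ⟨fun x => H (K.find x + 1) x, fun x => ?_, fun φ => ?_⟩
  · refine ⟨interior (K (K.find x + 1)),
      isOpen_interior.mem_nhds (K.subset_interior_succ _ (K.mem_find x)), ?_⟩
    refine ((hHi (K.find x + 1)).integrableOn (s := interior (K (K.find x + 1)))).congr_fun_ae ?_
    filter_upwards [ae_restrict_of_ae hHK, ae_restrict_mem isOpen_interior.measurableSet]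
      with y hy hy' using (hy _ hy').symm
  · obtain ⟨i, hi⟩ := K.exists_superset_of_isCompact φ.isCompact_preimage_tsupport
    have hi' : ((↑) ⁻¹' tsupport φ : Set U) ⊆ interior (K (i + 1)) :=
      hi.trans (K.subset_interior_succ i)
    rw [hH (i + 1) φ (hi'.trans interior_subset)]
    refine integral_congr_ae ?_
    filter_upwards [hHK] with x hx
    by_cases hxs : x ∈ ((↑) ⁻¹' tsupport φ : Set U)
    · simp only [hx (i + 1) (hi' hxs)]
    · simp [φ.eq_zero_of_notMem hxs]

/-- Decomposition of a test function subordinate to an open cover of its support. -/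
theorem exists_finset_sum_eq {E : Type*} [NormedAddCommGroup E] [NormedSpace ℝ E] (θ : 𝓓(U, E))
    (A : ℕ → Set (Rn n)) (hA : ∀ i, IsOpen (A i)) (hθ : tsupport θ ⊆ ⋃ i, A i) :
    ∃ (s : Finset ℕ) (η : ℕ → 𝓓(U, E)), θ = ∑ i ∈ s, η i ∧
      (∀ i, tsupport (η i) ⊆ A i ∩ tsupport θ) ∧ ∀ i x, ‖η i x‖ ≤ ‖θ x‖ := by
  obtain ⟨f, hf⟩ := SmoothPartitionOfUnity.exists_isSubordinate
    (modelWithCornersSelf ℝ (Rn n)) (isClosed_tsupport θ) A hA hθ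
  have hfin := f.locallyFinite.finite_nonempty_inter_compact θ.hasCompactSupport
  have hfs : ∀ i, ContDiff ℝ (⊤ : ℕ∞) (f i) := fun i => (f i).contMDiff.contDiff
  refine ⟨hfin.toFinset, fun i => smoothSmul (f i) (hfs i) θ, ?_, fun i =>
    Set.subset_inter ((tsupport_smoothSmul_subset_left _ _ _).trans (hf i))
      (tsupport_smoothSmul_subset_right _ _ _), fun i x => ?_⟩
  · ext x
    have hx' : (∑ i ∈ hfin.toFinset, smoothSmul (f i) (hfs i) θ) x =
        ∑ i ∈ hfin.toFinset, f i x • θ x := by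
      rw [FunLike.coe_sum, Finset.sum_apply]
      rfl
    rw [hx', ← Finset.sum_smul]
    by_cases hx : x ∈ tsupport θ
    · have h1 := f.sum_eq_one hx
      rw [finsum_eq_sum_of_support_subset (s := hfin.toFinset)] at h1
      · rw [h1, one_smul]
      · intro i hi
        simp only [Set.Finite.coe_toFinset, Set.mem_ofPred_eq]
        exact ⟨x, hi, hx⟩
    · rw [image_eq_zero_of_notMem_tsupport hx, smul_zero]
  · rw [smoothSmul_apply, norm_smul, Real.norm_of_nonneg (f.nonneg i x)]
    exact mul_le_of_le_one_left (norm_nonneg _) (f.le_one i x)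

end TestFunction

/-! ### Continuity of the first variation -/

namespace Varifold

variable {n m : ℕ} {U : Opens (Rn n)} (V : Varifold m U)

theorem dot_smul {P : Grass n m} (c : ℝ) (B : Rn n →L[ℝ] Rn n) : P.dot (c • B) = c * P.dot B := by
  have : P.proj ∘L (c • B) = c • (P.proj ∘L B) := by ext; simp
  rw [Grass.dot, this]
  exact map_smul (LinearMap.trace ℝ (Rn n)) c _

theorem dot_add {P : Grass n m} (A B : Rn n →L[ℝ] Rn n) : P.dot (A + B) = P.dot A + P.dot B := by
  simp only [Grass.dot, ContinuousLinearMap.comp_add]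
  exact map_add (LinearMap.trace ℝ (Rn n)) _ _

/-- The trace of a rank one map evaluates its functional at its vector. This is the term the product
rule contributes to `δV(Gθ)`. -/
theorem dot_smulRight (P : Grass n m) (l : Rn n →L[ℝ] ℝ) (v : Rn n) :
    P.dot (l.smulRight v) = l (P.proj v) := by
  have : ((P.proj ∘L l.smulRight v : Rn n →L[ℝ] Rn n) : Rn n →ₗ[ℝ] Rn n) =
      (l : Rn n →ₗ[ℝ] ℝ).smulRight (P.proj v) := by
    ext; simp
  rw [Grass.dot, this, LinearMap.trace_smulRight]
  rfl

theorem fderiv_test_add (θ η : 𝓓(U, Rn n)) (x : Rn n) :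
    fderiv ℝ (θ + η : 𝓓(U, Rn n)) x = fderiv ℝ θ x + fderiv ℝ η x := by
  rw [FunLike.coe_add]
  exact fderiv_add (θ.contDiff.differentiable (by simp) _) (η.contDiff.differentiable (by simp) _)

theorem fderiv_test_smul (c : ℝ) (θ : 𝓓(U, Rn n)) (x : Rn n) :
    fderiv ℝ (c • θ : 𝓓(U, Rn n)) x = c • fderiv ℝ θ x := by
  rw [FunLike.coe_smul]
  exact fderiv_const_smul (θ.contDiff.differentiable (by simp) _) c

/-- The first variation as a linear map. -/
def firstVariationₗ : 𝓓(U, Rn n) →ₗ[ℝ] ℝ where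
  toFun := V.firstVariation
  map_add' := V.firstVariation_add
  map_smul' c θ := by
    simp only [firstVariation, fderiv_test_smul, dot_smul, RingHom.id_apply, smul_eq_mul]
    exact integral_const_mul c _

@[simp] theorem firstVariationₗ_apply (θ : 𝓓(U, Rn n)) :
    V.firstVariationₗ θ = V.firstVariation θ := rfl

theorem firstVariation_smul (c : ℝ) (θ : 𝓓(U, Rn n)) :
    V.firstVariation (c • θ) = c * V.firstVariation θ :=
  map_smul V.firstVariationₗ c θ

theorem ofReal_firstVariation_le {θ : 𝓓(U, Rn n)} {A : Set U} (hθ : tsupport θ ⊆ (↑) '' A) {M : ℝ}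
    (hM : 0 < M) (hb : ∀ x, ‖θ x‖ ≤ M) :
    ENNReal.ofReal |V.firstVariation θ| ≤ ENNReal.ofReal M * V.variationOn A := by
  -- Both signs of `c` are used, which turns the one-sided supremum into a bound on the absolute
  -- value.
  have key : ∀ c : ℝ, |c| = M⁻¹ → ENNReal.ofReal (c * V.firstVariation θ) ≤ V.variationOn A := by
    intro c hc
    rw [← firstVariation_smul]
    refine le_iSup₂ (f := fun (θ : 𝓓(U, Rn n))
      (_ : tsupport θ ⊆ (↑) '' A ∧ ∀ x, ‖θ x‖ ≤ 1) =>
        ENNReal.ofReal (V.firstVariation θ)) (c • θ) ⟨?_, fun x => ?_⟩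
    · rw [FunLike.coe_smul]
      exact (tsupport_smul_subset_right (fun _ => c) θ).trans hθ
    · rw [FunLike.coe_smul, Pi.smul_apply, norm_smul, Real.norm_eq_abs, hc, inv_mul_le_iff₀ hM,
        mul_one]
      exact hb x
  have hMi : 0 < M⁻¹ := inv_pos.2 hM
  have h1 : ENNReal.ofReal (M⁻¹ * |V.firstVariation θ|) ≤ V.variationOn A := by
    rcases abs_cases (V.firstVariation θ) with ⟨h, -⟩ | ⟨h, -⟩
    · rw [h]
      exact key _ (abs_of_pos hMi)
    · rw [h, mul_neg, ← neg_mul]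
      exact key _ (by rw [abs_neg, abs_of_pos hMi])
  calc ENNReal.ofReal |V.firstVariation θ|
      = ENNReal.ofReal M * ENNReal.ofReal (M⁻¹ * |V.firstVariation θ|) := by
        rw [← ENNReal.ofReal_mul hM.le, mul_inv_cancel_left₀ hM.ne']
    _ ≤ _ := by gcongr

/-- A partition of unity splits a competitor for the union into finitely many competitors for single
members of the cover, because its support is compact. -/
theorem variationOn_iUnion_le {A : ℕ → Set U} (hA : ∀ i, IsOpen (A i)) :
    V.variationOn (⋃ i, A i) ≤ ∑' i, V.variationOn (A i) := by
  refine iSup₂_le fun θ hθ => ?_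
  obtain ⟨s, η, hsum, hη, hηθ⟩ := θ.exists_finset_sum_eq (fun i => (↑) '' A i)
    (fun i => U.isOpen.isOpenMap_subtype_val _ (hA i)) (by simpa [Set.image_iUnion] using hθ.1)
  calc ENNReal.ofReal (V.firstVariation θ)
      ≤ ENNReal.ofReal (∑ i ∈ s, |V.firstVariation (η i)|) := by
        refine ENNReal.ofReal_le_ofReal ?_
        rw [hsum, ← firstVariationₗ_apply, map_sum]
        exact Finset.sum_le_sum fun i _ => le_abs_self _
    _ = ∑ i ∈ s, ENNReal.ofReal |V.firstVariation (η i)| :=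
        ENNReal.ofReal_sum_of_nonneg fun _ _ => abs_nonneg _
    _ ≤ ∑ i ∈ s, V.variationOn (A i) := by
        refine Finset.sum_le_sum fun i _ => ?_
        have := V.ofReal_firstVariation_le ((hη i).trans Set.inter_subset_left) one_pos
          fun x => (hηθ i x).trans (hθ.2 x)
        simpa using this
    _ ≤ _ := ENNReal.sum_le_tsum s

/-- Countable subadditivity on open sets prevents the infimum over open covers from dropping below
the original value. Only this inequality enters the later estimates. -/
theorem variationOn_le_variation {A : Set U} (hA : IsOpen A) :
    V.variationOn A ≤ V.variation A := by
  rw [variation, toMeasure_apply _ _ hA.measurableSet, variationOuter, inducedOuterMeasure,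
    OuterMeasure.ofFunction_apply]
  refine le_iInf₂ fun B hB => ?_
  by_cases hBo : ∀ i, IsOpen (B i)
  · refine (V.variationOn_mono hB).trans ((V.variationOn_iUnion_le hBo).trans
      (ENNReal.tsum_le_tsum fun i => ?_))
    rw [extend_eq _ (hBo i)]
  · push Not at hBo
    obtain ⟨i, hi⟩ := hBo
    refine le_trans le_top (le_trans (le_of_eq ?_) (ENNReal.le_tsum i))
    exact (extend_eq_top _ hi).symm

/-- The field is cut into pieces supported where `|θ|` lies within `ε` of `kε`. Each piece is
bounded by `(k+1)ε ≤ |θ| + 2ε` on its layer, and every point lies in at most two layers. This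
overlap produces the factor `2`, which is harmless: only continuity in `L₁(‖δV‖)` is needed. -/
theorem ofReal_firstVariation_le_lintegral_add [IsFiniteMeasureOnCompacts V.variation]
    (θ : 𝓓(U, Rn n)) {A : Set U} (hA : IsOpen A) (hθA : ((↑) ⁻¹' tsupport θ : Set U) ⊆ A) {ε : ℝ}
    (hε : 0 < ε) :
    ENNReal.ofReal |V.firstVariation θ| ≤
      ∫⁻ x in A, 2 * (‖θ x‖ₑ + ENNReal.ofReal (2 * ε)) ∂V.variation := by
  set O : ℕ → Set (Rn n) := fun k => {x | ((k : ℝ) - 1) * ε < ‖θ x‖ ∧ ‖θ x‖ < ((k : ℝ) + 1) * ε}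
    with hO
  have hOo : ∀ k, IsOpen (O k) := fun k =>
    (isOpen_lt continuous_const θ.continuous.norm).inter
      (isOpen_lt θ.continuous.norm continuous_const)
  have hfloor : ∀ x, x ∈ O ⌊‖θ x‖ / ε⌋₊ := by
    intro x
    have h1 := Nat.floor_le (div_nonneg (norm_nonneg (θ x)) hε.le)
    have h2 := Nat.lt_floor_add_one (‖θ x‖ / ε)
    rw [le_div_iff₀ hε] at h1
    rw [div_lt_iff₀ hε] at h2
    exact ⟨by nlinarith, h2⟩
  obtain ⟨s, η, hsum, hη, hηθ⟩ := θ.exists_finset_sum_eq O hOo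
    fun x _ => Set.mem_iUnion.2 ⟨_, hfloor x⟩
  set Q : ℕ → Set U := fun k => (↑) ⁻¹' O k with hQ
  have hQo : ∀ k, IsOpen (Q k) := fun k => (hOo k).preimage continuous_subtype_val
  have hterm : ∀ k, ENNReal.ofReal |V.firstVariation (η k)| ≤
      ∫⁻ x in A, (Q k).indicator (fun _ => ENNReal.ofReal ((k + 1 : ℝ) * ε)) x ∂V.variation := by
    intro k
    rw [lintegral_indicator_const (hQo k).measurableSet,
      Measure.restrict_apply (hQo k).measurableSet]
    refine (V.ofReal_firstVariation_le (A := Q k ∩ A) (fun x hx => ?_) (by positivity)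
      fun x => ?_).trans (mul_le_mul_right (V.variationOn_le_variation ((hQo k).inter hA)) _)
    · have hx' := hη k hx
      exact ⟨⟨x, θ.tsupport_subset hx'.2⟩, ⟨hx'.1, hθA hx'.2⟩, rfl⟩
    · by_cases hx : x ∈ tsupport (η k)
      · exact (hηθ k x).trans (hη k hx).1.2.le
      · rw [image_eq_zero_of_notMem_tsupport hx, norm_zero]
        positivity
  calc ENNReal.ofReal |V.firstVariation θ|
      ≤ ENNReal.ofReal (∑ i ∈ s, |V.firstVariation (η i)|) := by
        refine ENNReal.ofReal_le_ofReal ?_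
        rw [hsum, ← firstVariationₗ_apply, map_sum]
        exact Finset.abs_sum_le_sum_abs _ _
    _ = ∑ i ∈ s, ENNReal.ofReal |V.firstVariation (η i)| :=
        ENNReal.ofReal_sum_of_nonneg fun _ _ => abs_nonneg _
    _ ≤ ∑ k ∈ s, ∫⁻ x in A, (Q k).indicator (fun _ => ENNReal.ofReal ((k + 1 : ℝ) * ε)) x
          ∂V.variation := Finset.sum_le_sum fun k _ => hterm k
    _ = ∫⁻ x in A, ∑ k ∈ s, (Q k).indicator (fun _ => ENNReal.ofReal ((k + 1 : ℝ) * ε)) x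
          ∂V.variation :=
        (lintegral_finsetSum _ fun k _ => measurable_const.indicator (hQo k).measurableSet).symm
    _ ≤ _ := by
        refine lintegral_mono fun x => ?_
        classical
        have hle : ∀ k ∈ s.filter fun k => x ∈ Q k,
            ENNReal.ofReal ((k + 1 : ℝ) * ε) ≤ ‖θ x‖ₑ + ENNReal.ofReal (2 * ε) := by
          intro k hk
          have hk' := (Finset.mem_filter.1 hk).2.1
          rw [← ofReal_norm, ← ENNReal.ofReal_add (norm_nonneg _) (by positivity)]
          refine ENNReal.ofReal_le_ofReal ?_
          nlinarith
        have hsub : (s.filter fun k => x ∈ Q k) ⊆ {⌊‖θ x‖ / ε⌋₊, ⌊‖θ x‖ / ε⌋₊ + 1} := by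
          intro k hk
          obtain ⟨h1, h2⟩ := (Finset.mem_filter.1 hk).2
          rw [← lt_div_iff₀ hε] at h1
          rw [← div_lt_iff₀ hε] at h2
          have h3 := Nat.floor_le (div_nonneg (norm_nonneg (θ x)) hε.le)
          have h4 := Nat.lt_floor_add_one (‖θ x‖ / ε)
          have h5 : (⌊‖θ x‖ / ε⌋₊ : ℝ) < (k : ℝ) + 1 := h3.trans_lt h2
          have h6 : (k : ℝ) < (⌊‖θ x‖ / ε⌋₊ : ℝ) + 2 := by linarith
          have h5' : ⌊‖θ x‖ / ε⌋₊ < k + 1 := by exact_mod_cast h5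
          have h6' : k < ⌊‖θ x‖ / ε⌋₊ + 2 := by exact_mod_cast h6
          simp only [Finset.mem_insert, Finset.mem_singleton]
          omega
        simp only [Set.indicator_apply]
        rw [← Finset.sum_filter]
        refine (Finset.sum_le_card_nsmul _ _ _ hle).trans ?_
        rw [nsmul_eq_mul]
        gcongr
        exact_mod_cast (Finset.card_le_card hsub).trans Finset.card_le_two

/-- On a neighbourhood of the support with finite measure, the extra `ε` term of the layer estimate
can be made arbitrarily small. -/
theorem ofReal_firstVariation_le_lintegral [IsFiniteMeasureOnCompacts V.variation]
    (θ : 𝓓(U, Rn n)) :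
    ENNReal.ofReal |V.firstVariation θ| ≤ 2 * ∫⁻ x, ‖θ x‖ₑ ∂V.variation := by
  obtain ⟨L, hL, hθL⟩ := exists_compact_superset θ.isCompact_preimage_tsupport
  have hfin : V.variation (interior L) ≠ ∞ :=
    ((measure_mono interior_subset).trans_lt hL.measure_lt_top).ne
  refine ENNReal.le_of_forall_pos_le_add fun δ hδ _ => ?_
  set M := (V.variation (interior L)).toReal with hM
  have hM0 : 0 ≤ M := ENNReal.toReal_nonneg
  -- Chosen so that the error term, `2 · 2ε · M`, is at most `δ`, also when `M = 0`.
  have hε : 0 < (δ : ℝ) / (4 * (M + 1)) := by positivity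
  refine (V.ofReal_firstVariation_le_lintegral_add θ isOpen_interior hθL hε).trans ?_
  have hmeas : Measurable fun x : U => ‖θ x‖ₑ := θ.continuous_restrict.measurable.enorm
  rw [lintegral_const_mul _ (by fun_prop), lintegral_add_left hmeas, mul_add, lintegral_const,
    Measure.restrict_apply_univ]
  gcongr
  · exact Measure.restrict_le_self
  · rw [← ENNReal.ofReal_toReal hfin, ← hM, ← ENNReal.ofReal_mul (by positivity),
      ← ENNReal.ofReal_ofNat 2, ← ENNReal.ofReal_mul (by positivity)]
    refine ENNReal.ofReal_le_of_le_toReal ?_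
    rw [ENNReal.coe_toReal]
    have : 2 * (2 * ((δ : ℝ) / (4 * (M + 1))) * M) = δ * (M / (M + 1)) := by
      field_simp; ring
    rw [this]
    exact mul_le_of_le_one_right δ.2 ((div_le_one (by positivity)).2 (by linarith))

end Varifold

namespace Varifold

variable {n m : ℕ} {U : Opens (Rn n)} (V : Varifold m U)

/-! ### The extension of the first variation -/

section Extension

variable [hV : IsFiniteMeasureOnCompacts V.variation]

/-- The class in `L₁(‖δV‖, ℝⁿ)` of a test vector field. -/
def testToL1 : 𝓓(U, Rn n) →ₗ[ℝ] Lp (Rn n) 1 V.variation where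
  toFun θ := (θ.memLp_restrict V.variation 1).toLp
  map_add' _ _ := rfl
  map_smul' _ _ := rfl

theorem coeFn_testToL1 (θ : 𝓓(U, Rn n)) : V.testToL1 θ =ᵐ[V.variation] fun x : U => θ x :=
  (θ.memLp_restrict V.variation 1).coeFn_toLp

theorem edist_testToL1 (θ : 𝓓(U, Rn n)) {η : U → Rn n} (hη : MemLp η 1 V.variation) :
    edist (V.testToL1 θ) hη.toLp = eLpNorm (fun x : U => θ x - η x) 1 V.variation := by
  rw [Lp.edist_def]
  refine eLpNorm_congr_ae ?_
  filter_upwards [V.coeFn_testToL1 θ, hη.coeFn_toLp] with x h1 h2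
  simp [h1, h2]

theorem exists_eLpNorm_test_sub_le {η : U → Rn n} (hη : MemLp η 1 V.variation) {ε : ℝ≥0∞}
    (hε : ε ≠ 0) : ∃ θ : 𝓓(U, Rn n), eLpNorm (fun x : U => θ x - η x) 1 V.variation ≤ ε := by
  obtain ⟨θ, hθ⟩ := TestFunction.exists_eLpNorm_sub_le ENNReal.one_ne_top le_rfl hη hε
  refine ⟨θ, ?_⟩
  have := eLpNorm_sub_comm (fun x : U => θ x) η 1 V.variation
  exact (le_of_eq this).trans hθ

theorem denseRange_testToL1 : DenseRange V.testToL1 := by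
  intro f
  refine EMetric.mem_closure_iff.2 fun ε hε => ?_
  obtain ⟨θ, hθ⟩ := V.exists_eLpNorm_test_sub_le (Lp.memLp f) (ENNReal.half_pos hε.ne').ne'
  rw [← V.edist_testToL1 θ (Lp.memLp f), Lp.toLp_coeFn] at hθ
  rcases eq_or_ne ε ∞ with rfl | hεt
  · exact ⟨_, ⟨θ, rfl⟩, edist_lt_top _ _⟩
  · refine ⟨_, ⟨θ, rfl⟩, ?_⟩
    rw [edist_comm]
    exact hθ.trans_lt (ENNReal.half_lt_self hε.ne' hεt)

theorem norm_firstVariation_le (θ : 𝓓(U, Rn n)) :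
    ‖V.firstVariationₗ θ‖ ≤ 2 * ‖V.testToL1 θ‖ := by
  have h1 := V.ofReal_firstVariation_le_lintegral θ
  rw [← eLpNorm_one_eq_lintegral_enorm, ← eLpNorm_congr_ae (V.coeFn_testToL1 θ)] at h1
  have h2 := ENNReal.toReal_mono (ENNReal.mul_ne_top (by simp) (Lp.eLpNorm_ne_top _)) h1
  rw [ENNReal.toReal_ofReal (abs_nonneg _), ENNReal.toReal_mul] at h2
  exact h2

/-- The first variation as a continuous functional on `L₁(‖δV‖, ℝⁿ)`. -/
def firstVariationL1 : Lp (Rn n) 1 V.variation →L[ℝ] ℝ :=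
  V.firstVariationₗ.extendOfNorm V.testToL1

theorem firstVariationL1_testToL1 (θ : 𝓓(U, Rn n)) :
    V.firstVariationL1 (V.testToL1 θ) = V.firstVariation θ :=
  LinearMap.extendOfNorm_eq V.denseRange_testToL1 ⟨2, V.norm_firstVariation_le⟩ θ

theorem norm_firstVariationL1_le (f : Lp (Rn n) 1 V.variation) :
    ‖V.firstVariationL1 f‖ ≤ 2 * ‖f‖ :=
  LinearMap.norm_extendOfNorm_apply_le V.denseRange_testToL1 2 V.norm_firstVariation_le f

/-- The limit defining the extension is meaningful because density of the test fields makes the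
filter nontrivial; continuity in `L₁` then identifies it. -/
theorem firstVariationExt_eq {η : U → Rn n} (hη : MemLp η 1 V.variation) :
    V.firstVariationExt η = V.firstVariationL1 hη.toLp := by
  have hne : (V.testNhds η).NeBot := by
    refine comap_neBot fun t ht => ?_
    obtain ⟨ε, hε, hεt⟩ := ENNReal.nhds_zero_basis_Iic.mem_iff.1 ht
    obtain ⟨θ, hθ⟩ := V.exists_eLpNorm_test_sub_le hη hε.ne'
    exact ⟨θ, hεt hθ⟩
  refine Tendsto.limUnder_eq ?_
  have h1 : Tendsto V.testToL1 (V.testNhds η) (𝓝 hη.toLp) := by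
    rw [tendsto_iff_edist_tendsto_0]
    simp_rw [edist_testToL1]
    exact tendsto_comap
  refine ((V.firstVariationL1.continuous.tendsto _).comp h1).congr fun θ => ?_
  exact V.firstVariationL1_testToL1 θ

theorem firstVariationExt_add {η ζ : U → Rn n} (hη : MemLp η 1 V.variation)
    (hζ : MemLp ζ 1 V.variation) :
    V.firstVariationExt (η + ζ) = V.firstVariationExt η + V.firstVariationExt ζ := by
  rw [V.firstVariationExt_eq hη, V.firstVariationExt_eq hζ, V.firstVariationExt_eq (hη.add hζ),
    MemLp.toLp_add, map_add]

theorem firstVariationExt_smul (c : ℝ) {η : U → Rn n} (hη : MemLp η 1 V.variation) :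
    V.firstVariationExt (c • η) = c * V.firstVariationExt η := by
  rw [V.firstVariationExt_eq hη, V.firstVariationExt_eq (hη.const_smul c),
    MemLp.toLp_const_smul, map_smul, smul_eq_mul]

theorem firstVariationExt_test (θ : 𝓓(U, Rn n)) :
    V.firstVariationExt (fun x : U => θ x) = V.firstVariation θ := by
  rw [V.firstVariationExt_eq (θ.memLp_restrict V.variation 1)]
  exact V.firstVariationL1_testToL1 θ

theorem abs_firstVariationExt_le {η : U → Rn n} (hη : Integrable η V.variation) :
    |V.firstVariationExt η| ≤ 2 * ∫ x, ‖η x‖ ∂V.variation := by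
  have hη' : MemLp η 1 V.variation := memLp_one_iff_integrable.2 hη
  rw [V.firstVariationExt_eq hη']
  refine (V.norm_firstVariationL1_le _).trans (le_of_eq ?_)
  rw [Lp.norm_toLp, eLpNorm_one_eq_lintegral_enorm, ← integral_norm_eq_lintegral_enorm hη.1]

end Extension

/-! ### The weight measure -/

instance isFiniteMeasureOnCompacts_measure : IsFiniteMeasureOnCompacts V.measure :=
  V.finiteOnCompacts

instance isFiniteMeasureOnCompacts_weight : IsFiniteMeasureOnCompacts V.weight where
  lt_top_of_isCompact := by
    intro K hK
    rw [weight, Measure.map_apply measurable_fst hK.measurableSet, ← Set.prod_univ]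
    exact (hK.prod isCompact_univ).measure_lt_top

theorem integral_weight {E : Type*} [NormedAddCommGroup E] [NormedSpace ℝ E] {h : U → E}
    (hh : AEStronglyMeasurable h V.weight) :
    ∫ x, h x ∂V.weight = ∫ z, h z.1 ∂V.measure :=
  integral_map measurable_fst.aemeasurable hh

theorem quasiMeasurePreserving_fst : Measure.QuasiMeasurePreserving Prod.fst V.measure V.weight :=
  ⟨measurable_fst, Measure.AbsolutelyContinuous.rfl⟩

theorem integrable_comp_fst {E : Type*} [NormedAddCommGroup E] {h : U → E}
    (hh : Integrable h V.weight) : Integrable (fun z : U × Grass n m => h z.1) V.measure :=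
  hh.comp_measurable measurable_fst

/-! ### The functional measuring the distributional derivative -/

theorem continuous_dot_fderiv (θ : 𝓓(U, Rn n)) :
    Continuous fun z : U × Grass n m => z.2.dot (fderiv ℝ θ z.1) := by
  have hD : Continuous (fderiv ℝ θ) := θ.contDiff.continuous_fderiv (by simp)
  have hproj : Continuous (Grass.proj : Grass n m → _) := (Grass.isInducing_proj n m).continuous
  have : Continuous (fun z : U × Grass n m =>
      traceCLM n (z.2.proj ∘L fderiv ℝ θ (z.1 : Rn n))) :=
    (traceCLM n).continuous.comp
      ((hproj.comp continuous_snd).clm_comp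
        (hD.comp (continuous_subtype_val.comp continuous_fst)))
  exact this

theorem dot_fderiv_eq_zero (θ : 𝓓(U, Rn n)) {x : U} (hx : x ∉ ((↑) ⁻¹' tsupport θ : Set U))
    (P : Grass n m) : P.dot (fderiv ℝ θ (x : Rn n)) = 0 := by
  simp [θ.fderiv_eq_zero_of_notMem hx, Grass.dot]

theorem integrable_of_eq_zero_off_tsupport {E : Type*} [NormedAddCommGroup E] (θ : 𝓓(U, Rn n))
    {h : U × Grass n m → E} (hh : Continuous h)
    (h0 : ∀ z, z.1 ∉ ((↑) ⁻¹' tsupport θ : Set U) → h z = 0) : Integrable h V.measure := by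
  refine hh.integrable_of_hasCompactSupport (HasCompactSupport.intro
    (θ.isCompact_preimage_tsupport.prod (isCompact_univ (X := Grass n m))) fun z hz => h0 z ?_)
  exact fun hz' => hz ⟨hz', trivial⟩

theorem integrable_mul_dot (g : C(U, ℝ)) (θ : 𝓓(U, Rn n)) :
    Integrable (fun z : U × Grass n m => g z.1 * z.2.dot (fderiv ℝ θ z.1)) V.measure := by
  refine V.integrable_of_eq_zero_off_tsupport θ
    ((g.continuous.comp continuous_fst).mul (continuous_dot_fderiv θ)) fun z hz => ?_
  rw [dot_fderiv_eq_zero θ hz, mul_zero]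

theorem memLp_smul_test {μ : Measure U} [IsFiniteMeasureOnCompacts μ] (g : C(U, ℝ))
    (θ : 𝓓(U, Rn n)) (p : ℝ≥0∞) : MemLp (fun x : U => g x • θ x) p μ :=
  (g.continuous.smul θ.continuous_restrict).memLp_of_hasCompactSupport
    θ.hasCompactSupport_restrict.smul_left

variable [hV : IsFiniteMeasureOnCompacts V.variation]

/-- The functional `θ ↦ (δV)(g θ) - ∫ g(x) P♮ • Dθ(x) dV(x,P)`, for a continuous function `g`. -/
def derivFunctional : C(U, ℝ) →ₗ[ℝ] 𝓓(U, Rn n) →ₗ[ℝ] ℝ :=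
  LinearMap.mk₂ ℝ (fun g θ => V.firstVariationExt (fun x => g x • θ x) -
      ∫ z : U × Grass n m, g z.1 * z.2.dot (fderiv ℝ θ z.1) ∂V.measure)
    (by
      intro g h θ
      have h1 : (fun x : U => (g + h) x • θ x) = (fun x : U => g x • θ x) +
          fun x : U => h x • θ x := by ext1 x; simp [add_smul]
      have h2 : ∀ z : U × Grass n m, (g + h) z.1 * z.2.dot (fderiv ℝ θ z.1) =
          g z.1 * z.2.dot (fderiv ℝ θ z.1) + h z.1 * z.2.dot (fderiv ℝ θ z.1) := fun z => by
        simp [add_mul]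
      simp_rw [h2]
      rw [h1, V.firstVariationExt_add (memLp_smul_test g θ 1) (memLp_smul_test h θ 1),
        integral_add (V.integrable_mul_dot g θ) (V.integrable_mul_dot h θ)]
      ring)
    (by
      intro c g θ
      have h1 : (fun x : U => (c • g) x • θ x) = c • fun x : U => g x • θ x := by
        ext1 x; simp [mul_smul]
      have h2 : ∀ z : U × Grass n m, (c • g) z.1 * z.2.dot (fderiv ℝ θ z.1) =
          c * (g z.1 * z.2.dot (fderiv ℝ θ z.1)) := fun z => by simp [mul_assoc]
      simp_rw [h2]
      rw [h1, V.firstVariationExt_smul c (memLp_smul_test g θ 1), integral_const_mul, smul_eq_mul]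
      ring)
    (by
      intro g θ η
      have h1 : (fun x : U => g x • (θ + η) x) = (fun x : U => g x • θ x) +
          fun x : U => g x • η x := by ext1 x; simp [smul_add]
      have h2 : ∀ z : U × Grass n m, g z.1 * z.2.dot (fderiv ℝ (θ + η : 𝓓(U, Rn n)) z.1) =
          g z.1 * z.2.dot (fderiv ℝ θ z.1) + g z.1 * z.2.dot (fderiv ℝ η z.1) := fun z => by
        rw [fderiv_test_add, dot_add, mul_add]
      simp_rw [h2]
      rw [h1, V.firstVariationExt_add (memLp_smul_test g θ 1) (memLp_smul_test g η 1),
        integral_add (V.integrable_mul_dot g θ) (V.integrable_mul_dot g η)]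
      ring)
    (by
      intro c g θ
      have h1 : (fun x : U => g x • (c • θ) x) = c • fun x : U => g x • θ x := by
        ext1 x; simp [smul_smul, mul_comm]
      have h2 : ∀ z : U × Grass n m, g z.1 * z.2.dot (fderiv ℝ (c • θ : 𝓓(U, Rn n)) z.1) =
          c * (g z.1 * z.2.dot (fderiv ℝ θ z.1)) := fun z => by
        rw [fderiv_test_smul, dot_smul]; ring
      simp_rw [h2]
      rw [h1, V.firstVariationExt_smul c (memLp_smul_test g θ 1), integral_const_mul, smul_eq_mul]
      ring)

theorem derivFunctional_apply (g : C(U, ℝ)) (θ : 𝓓(U, Rn n)) :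
    V.derivFunctional g θ = V.firstVariationExt (fun x => g x • θ x) -
      ∫ z : U × Grass n m, g z.1 * z.2.dot (fderiv ℝ θ z.1) ∂V.measure := rfl

/-- Locality: both `θ` and `Dθ` vanish off the support of `θ`. -/
theorem derivFunctional_congr {g h : C(U, ℝ)} {θ : 𝓓(U, Rn n)}
    (hgh : Set.EqOn g h ((↑) ⁻¹' tsupport θ)) : V.derivFunctional g θ = V.derivFunctional h θ := by
  have h1 : (fun x : U => g x • θ x) = fun x : U => h x • θ x := by
    ext1 x
    by_cases hx : x ∈ ((↑) ⁻¹' tsupport θ : Set U)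
    · rw [hgh hx]
    · rw [θ.eq_zero_of_notMem hx, smul_zero, smul_zero]
  have h2 : ∀ z : U × Grass n m, g z.1 * z.2.dot (fderiv ℝ θ z.1) =
      h z.1 * z.2.dot (fderiv ℝ θ z.1) := by
    intro z
    by_cases hx : z.1 ∈ ((↑) ⁻¹' tsupport θ : Set U)
    · rw [hgh hx]
    · rw [dot_fderiv_eq_zero θ hx, mul_zero, mul_zero]
  rw [derivFunctional_apply, derivFunctional_apply, h1, integral_congr_ae (.of_forall h2)]

theorem abs_derivFunctional_le (g : C(U, ℝ)) (θ : 𝓓(U, Rn n)) :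
    |V.derivFunctional g θ| ≤ 2 * ∫ x, ‖g x • θ x‖ ∂V.variation +
      ∫ z : U × Grass n m, ‖g z.1 * z.2.dot (fderiv ℝ θ z.1)‖ ∂V.measure := by
  rw [derivFunctional_apply]
  refine (abs_sub _ _).trans (add_le_add
    (V.abs_firstVariationExt_le (memLp_one_iff_integrable.1 (memLp_smul_test g θ 1))) ?_)
  rw [← Real.norm_eq_abs]
  exact norm_integral_le_integral_norm _

/-- By linearity the difference is the functional of `g i - h`, which is bounded by two integrals,
against `‖δV‖` and `V`; dominated convergence sends both to zero. -/
theorem tendsto_derivFunctional {g : ℕ → C(U, ℝ)} {h : C(U, ℝ)} {θ : 𝓓(U, Rn n)} {B : ℝ}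
    (hB : ∀ᶠ i in atTop, ∀ x : U, x ∈ ((↑) ⁻¹' tsupport θ : Set U) → ‖g i x‖ ≤ B)
    (hlim : ∀ x : U, x ∈ ((↑) ⁻¹' tsupport θ : Set U) →
      Tendsto (fun i => g i x) atTop (𝓝 (h x))) :
    Tendsto (fun i => V.derivFunctional (g i) θ) atTop (𝓝 (V.derivFunctional h θ)) := by
  have hhB : ∀ x : U, x ∈ ((↑) ⁻¹' tsupport θ : Set U) → ‖h x‖ ≤ B := fun x hx =>
    le_of_tendsto (hlim x hx).norm (hB.mono fun i hi => hi x hx)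
  have hd : ∀ᶠ i in atTop, ∀ x : U, x ∈ ((↑) ⁻¹' tsupport θ : Set U) →
      ‖(g i - h) x‖ ≤ B + B := hB.mono fun i hi x hx =>
    (norm_sub_le _ _).trans (add_le_add (hi x hx) (hhB x hx))
  have hlim' : ∀ x : U, x ∈ ((↑) ⁻¹' tsupport θ : Set U) →
      Tendsto (fun i => (g i - h) x) atTop (𝓝 0) := fun x hx => by
    simpa using (hlim x hx).sub_const (h x)
  rw [tendsto_iff_norm_sub_tendsto_zero]
  simp_rw [← LinearMap.sub_apply, ← map_sub]
  have t1 : Tendsto (fun i => ∫ x : U, ‖(g i - h) x • θ x‖ ∂V.variation) atTop (𝓝 0) := by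
    rw [← integral_zero U ℝ (μ := V.variation)]
    refine tendsto_integral_filter_of_dominated_convergence (fun x : U => (B + B) * ‖θ x‖)
      (.of_forall fun i => (memLp_smul_test _ θ 1).1.norm) (hd.mono fun i hi => .of_forall fun x => ?_)
      ((θ.integrable_restrict _).norm.const_mul _) (.of_forall fun x => ?_)
    · by_cases hx : x ∈ ((↑) ⁻¹' tsupport θ : Set U)
      · rw [norm_norm, norm_smul]
        exact mul_le_mul_of_nonneg_right (hi x hx) (norm_nonneg _)
      · simp [θ.eq_zero_of_notMem hx]
    · by_cases hx : x ∈ ((↑) ⁻¹' tsupport θ : Set U)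
      · simpa using ((hlim' x hx).smul_const (θ x)).norm
      · simp [θ.eq_zero_of_notMem hx]
  have t2 : Tendsto (fun i => ∫ z : U × Grass n m,
      ‖(g i - h) z.1 * z.2.dot (fderiv ℝ θ z.1)‖ ∂V.measure) atTop (𝓝 0) := by
    rw [← integral_zero (U × Grass n m) ℝ (μ := V.measure)]
    refine tendsto_integral_filter_of_dominated_convergence
      (fun z : U × Grass n m => (B + B) * ‖z.2.dot (fderiv ℝ θ z.1)‖)
      (.of_forall fun i => (V.integrable_mul_dot _ θ).1.norm)
      (hd.mono fun i hi => .of_forall fun z => ?_)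
      ((V.integrable_dot θ).norm.const_mul _) (.of_forall fun z => ?_)
    · by_cases hx : z.1 ∈ ((↑) ⁻¹' tsupport θ : Set U)
      · rw [norm_norm, norm_mul]
        exact mul_le_mul_of_nonneg_right (hi _ hx) (norm_nonneg _)
      · simp [dot_fderiv_eq_zero θ hx]
    · by_cases hx : z.1 ∈ ((↑) ⁻¹' tsupport θ : Set U)
      · simpa using ((hlim' _ hx).mul_const (z.2.dot (fderiv ℝ θ z.1))).norm
      · simp [dot_fderiv_eq_zero θ hx]
  refine squeeze_zero (fun i => norm_nonneg _) (fun i => V.abs_derivFunctional_le (g i - h) θ) ?_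
  simpa using (t1.const_mul 2).add t2

/-- Here `Gθ` is itself a test field. In `P♮ • D(Gθ)` the product rule gives `G P♮ • Dθ`, which
cancels, and the rank one term, which remains. -/
theorem derivFunctional_of_contDiff {G : Rn n → ℝ} (hG : ContDiff ℝ (⊤ : ℕ∞) G) {g : C(U, ℝ)}
    (hg : ∀ x : U, g x = G x) (θ : 𝓓(U, Rn n)) :
    V.derivFunctional g θ = ∫ z : U × Grass n m, fderiv ℝ G z.1 (z.2.proj (θ z.1)) ∂V.measure := by
  have h1 : (fun x : U => g x • θ x) = fun x : U => TestFunction.smoothSmul G hG θ x := by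
    ext1 x; simp [hg x]
  rw [derivFunctional_apply, h1, firstVariationExt_test, firstVariation,
    ← integral_sub (V.integrable_dot _) (V.integrable_mul_dot g θ)]
  refine integral_congr_ae (.of_forall fun z => ?_)
  have hd : fderiv ℝ (TestFunction.smoothSmul G hG θ : 𝓓(U, Rn n)) (z.1 : Rn n) =
      G z.1 • fderiv ℝ θ z.1 + (fderiv ℝ G z.1).smulRight (θ z.1) :=
    fderiv_fun_smul (hG.differentiable (by simp) _) (θ.contDiff.differentiable (by simp) _)
  simp only [hd, dot_add, dot_smul, dot_smulRight, hg z.1]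
  ring

end Varifold

/-! ### Smooth approximation of Lipschitzian functions -/

/-- Convolution with a probability density averages translates of `f`, so it preserves the Lipschitz
constant; a kernel supported in a ball of radius `ε` moves values by at most `Cε`. -/
theorem LipschitzWith.exists_contDiff_approx {E Y : Type*} [NormedAddCommGroup E] [NormedSpace ℝ E]
    [FiniteDimensional ℝ E] [MeasurableSpace E] [BorelSpace E] [NormedAddCommGroup Y]
    [NormedSpace ℝ Y] [CompleteSpace Y] {C : ℝ≥0} {f : E → Y} (hf : LipschitzWith C f) {ε : ℝ}
    (hε : 0 < ε) :
    ∃ g : E → Y, ContDiff ℝ (⊤ : ℕ∞) g ∧ LipschitzWith C g ∧ ∀ x, dist (g x) (f x) ≤ C * ε := by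
  let φ : ContDiffBump (0 : E) := ⟨ε / 2, ε, half_pos hε, half_lt_self hε⟩
  let μ : Measure E := Measure.addHaar
  let L := ContinuousLinearMap.lsmul ℝ ℝ (E := Y)
  have hfl : LocallyIntegrable f μ := hf.continuous.locallyIntegrable
  have hex : ConvolutionExists (φ.normed μ) f L μ :=
    φ.hasCompactSupport_normed.convolutionExists_left L φ.continuous_normed hfl
  refine ⟨convolution (φ.normed μ) f L μ,
    φ.hasCompactSupport_normed.contDiff_convolution_left L φ.contDiff_normed hfl,
    LipschitzWith.of_dist_le_mul fun x y => ?_, fun x => ?_⟩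
  · rw [dist_eq_norm, convolution_def, convolution_def, ← integral_sub (hex x) (hex y)]
    calc ‖∫ t, (L (φ.normed μ t) (f (x - t)) - L (φ.normed μ t) (f (y - t))) ∂μ‖
        ≤ ∫ t, φ.normed μ t * (C * dist x y) ∂μ := by
          refine norm_integral_le_of_norm_le (φ.integrable_normed.mul_const _)
            (.of_forall fun t => ?_)
          rw [← map_sub]
          simp only [L, ContinuousLinearMap.lsmul_apply]
          rw [norm_smul, Real.norm_of_nonneg (φ.nonneg_normed t), ← dist_eq_norm]
          refine mul_le_mul_of_nonneg_left ?_ (φ.nonneg_normed t)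
          simpa using hf.dist_le_mul (x - t) (y - t)
      _ = C * dist x y := by rw [integral_mul_const, φ.integral_normed, one_mul]
  · refine φ.dist_normed_convolution_le hf.continuous.aestronglyMeasurable fun y hy => ?_
    exact (hf.dist_le_mul y x).trans (mul_le_mul_of_nonneg_left (Metric.mem_ball.1 hy).le C.2)

/-- Uniform bounds for the composition with a uniformly convergent sequence. -/
theorem exists_eventually_norm_comp_le {X Y Z : Type*} [TopologicalSpace X] [NormedAddCommGroup Y]
    [ProperSpace Y] [NormedAddCommGroup Z] {Ψ : Y → Z} (hΨ : Continuous Ψ)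
    {f : ℕ → X → Y} {f' : X → Y} {K : Set X} (hK : IsCompact K) (hf' : ContinuousOn f' K)
    (hf : TendstoUniformlyOn f f' atTop K) :
    ∃ B, ∀ᶠ i in atTop, ∀ x ∈ K, ‖Ψ (f i x)‖ ≤ B := by
  have hc : IsCompact (Metric.cthickening 1 (f' '' K)) := (hK.image_of_continuousOn hf').cthickening
  obtain ⟨B, hB⟩ := hc.exists_bound_of_continuousOn hΨ.continuousOn
  refine ⟨B, ?_⟩
  filter_upwards [Metric.tendstoUniformlyOn_iff.1 hf 1 one_pos] with i hi x hx
  refine hB _ (Metric.mem_cthickening_of_dist_le _ (f' x) _ _ (Set.mem_image_of_mem _ hx) ?_)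
  rw [dist_comm]
  exact (hi x hx).le

namespace Varifold

variable {n m : ℕ} {U : Opens (Rn n)} (V : Varifold m U)
variable {Y : Type*} [NormedAddCommGroup Y] [NormedSpace ℝ Y]

/-! ### The chain rule for continuous functions -/

/-- The functional `H ↦ ⟨θ(x), Dγ(f(x)) ∘ H⟩` on `Hom(ℝⁿ, Y)`. -/
def chainCoeff (γ : Y → ℝ) (f : U → Y) (θ : 𝓓(U, Rn n)) (x : U) : (Rn n →L[ℝ] Y) →L[ℝ] ℝ :=
  (fderiv ℝ γ (f x)).comp (ContinuousLinearMap.apply ℝ Y (θ x))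

@[simp] theorem chainCoeff_apply (γ : Y → ℝ) (f : U → Y) (θ : 𝓓(U, Rn n)) (x : U)
    (H : Rn n →L[ℝ] Y) : chainCoeff γ f θ x H = fderiv ℝ γ (f x) (H (θ x)) := rfl

theorem continuous_chainCoeff {γ : Y → ℝ} (hγ : ContDiff ℝ (⊤ : ℕ∞) γ) {f : U → Y}
    (hf : Continuous f) (θ : 𝓓(U, Rn n)) : Continuous (chainCoeff γ f θ) :=
  ((hγ.continuous_fderiv (by simp)).comp hf).clm_comp
    ((ContinuousLinearMap.apply ℝ Y).continuous.comp θ.continuous_restrict)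

theorem chainCoeff_eq_zero (γ : Y → ℝ) (f : U → Y) (θ : 𝓓(U, Rn n)) {x : U}
    (hx : x ∉ ((↑) ⁻¹' tsupport θ : Set U)) : chainCoeff γ f θ x = 0 := by
  ext H
  simp [θ.eq_zero_of_notMem hx]

theorem hasCompactSupport_chainCoeff (γ : Y → ℝ) (f : U → Y) (θ : 𝓓(U, Rn n)) :
    HasCompactSupport (chainCoeff γ f θ) :=
  HasCompactSupport.intro θ.isCompact_preimage_tsupport fun _ hx => chainCoeff_eq_zero γ f θ hx

theorem integrable_clm_apply {H : Type*} [NormedAddCommGroup H] [NormedSpace ℝ H] {μ : Measure U}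
    {A : U → (H →L[ℝ] ℝ)} (hA : Continuous A) (hAc : HasCompactSupport A) {F : U → H}
    (hF : LocallyIntegrable F μ) : Integrable (fun x => A x (F x)) μ := by
  have hFn : LocallyIntegrable (fun x => ‖F x‖) μ := fun x =>
    let ⟨s, hs, hi⟩ := hF x
    ⟨s, hs, hi.norm⟩
  have h1 := hFn.integrable_smul_left_of_hasCompactSupport hA.norm hAc.norm
  refine h1.mono' ?_ (.of_forall fun x => (A x).le_opNorm (F x))
  exact (ContinuousLinearMap.id ℝ (H →L[ℝ] ℝ)).aestronglyMeasurable_comp₂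
    hA.aestronglyMeasurable hF.aestronglyMeasurable

theorem integral_weakDeriv_eq_add {γ : Y → ℝ} (hγ : ContDiff ℝ (⊤ : ℕ∞) γ) (f : C(U, Y))
    {F : U → (Rn n →L[ℝ] Y)} (hF : LocallyIntegrable F V.weight) (θ : 𝓓(U, Rn n)) :
    ∫ z : U × Grass n m,
        (γ (f z.1) * z.2.dot (fderiv ℝ θ z.1) + fderiv ℝ γ (f z.1) (F z.1 (θ z.1))) ∂V.measure =
      ∫ z : U × Grass n m, γ (f z.1) * z.2.dot (fderiv ℝ θ z.1) ∂V.measure +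
        ∫ z : U × Grass n m, fderiv ℝ γ (f z.1) (F z.1 (θ z.1)) ∂V.measure :=
  integral_add (V.integrable_mul_dot ((⟨γ, hγ.continuous⟩ : C(Y, ℝ)).comp f) θ)
    (V.integrable_comp_fst (integrable_clm_apply (continuous_chainCoeff hγ f.continuous θ)
      (hasCompactSupport_chainCoeff γ f θ) hF))

variable {V} in
-- A continuous `f` is bounded on compact sets, so truncating at a large level removes nothing.
theorem IsWeakDeriv.locallyIntegrable {f : C(U, Y)} {F : U → (Rn n →L[ℝ] Y)}
    (h : V.IsWeakDeriv f F) : LocallyIntegrable F V.weight := by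
  intro x
  obtain ⟨K, hK, hx⟩ := exists_compact_mem_nhds x
  refine ⟨K, hx, h.measurable_deriv.restrict, ?_⟩
  obtain ⟨s, hs⟩ := hK.exists_bound_of_continuousOn f.continuous.continuousOn
  have h1 := h.integral_lt_top K hK s ((norm_nonneg _).trans (hs x (mem_of_mem_nhds hx)))
  have h2 : K ∩ {x | ‖f x‖ ≤ s} = K := Set.inter_eq_self_of_subset_left hs
  rwa [h2] at h1

variable [hV : IsFiniteMeasureOnCompacts V.variation]

/-- The chain rule, for a derivative depending on points and planes. -/
def HasChainRule (f : C(U, Y)) (D : U × Grass n m → (Rn n →L[ℝ] Y)) : Prop :=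
  ∀ (γ : Y → ℝ) (hγ : ContDiff ℝ (⊤ : ℕ∞) γ) (θ : 𝓓(U, Rn n)),
    V.derivFunctional ((⟨γ, hγ.continuous⟩ : C(Y, ℝ)).comp f) θ =
      ∫ z : U × Grass n m, fderiv ℝ γ (f z.1) (D z (θ z.1)) ∂V.measure

variable {V}

theorem HasChainRule.linear {f : C(U, Y)} {D : U × Grass n m → (Rn n →L[ℝ] Y)}
    (h : V.HasChainRule f D) (l : Y →L[ℝ] ℝ) (θ : 𝓓(U, Rn n)) :
    V.derivFunctional ((l : C(Y, ℝ)).comp f) θ =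
      ∫ z : U × Grass n m, l (D z (θ z.1)) ∂V.measure := by
  simpa using h l l.contDiff θ

theorem isWeakDeriv_of_hasChainRule {f : C(U, Y)} [FiniteDimensional ℝ Y]
    {F : U → (Rn n →L[ℝ] Y)} (hF : LocallyIntegrable F V.weight)
    (h : V.HasChainRule f fun z => F z.1) : V.IsWeakDeriv f F := by
  have : ProperSpace Y := FiniteDimensional.proper_real _
  refine ⟨f.continuous.aestronglyMeasurable, hF.aestronglyMeasurable, fun K hK s _ => ?_,
    fun θ γ hγ _ => ?_⟩
  · exact (lintegral_mono_set Set.inter_subset_left).trans_lt (hF.integrableOn_isCompact hK).2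
  · have h1 := h γ hγ θ
    rw [derivFunctional_apply, sub_eq_iff_eq_add'] at h1
    rw [V.integral_weakDeriv_eq_add hγ f hF θ]
    exact h1

/-- Compact support of `Dγ` is no restriction when `f` is continuous: multiplying `γ` by a cutoff
equal to one near the compact image of the support of `θ` changes neither side. In particular `γ`
may be linear. -/
theorem IsWeakDeriv.hasChainRule [FiniteDimensional ℝ Y] {f : C(U, Y)} {F : U → (Rn n →L[ℝ] Y)}
    (h : V.IsWeakDeriv f F) : V.HasChainRule f fun z => F z.1 := by
  have : ProperSpace Y := FiniteDimensional.proper_real _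
  intro γ hγ θ
  set K : Set U := (↑) ⁻¹' tsupport θ
  have hK : IsCompact K := θ.isCompact_preimage_tsupport
  obtain ⟨s, hs⟩ := hK.exists_bound_of_continuousOn f.continuous.continuousOn
  have hs' : ∀ x ∈ K, ‖f x‖ < |s| + 1 := fun x hx => by
    linarith [hs x hx, le_abs_self s]
  -- The inner radius strictly exceeds the bound of `f` on `K`, so `χ` is one in a neighbourhood of
  -- each `f x` and the derivatives agree as well.
  let χ : ContDiffBump (0 : Y) := ⟨|s| + 1, |s| + 2, by positivity, by linarith⟩
  have hγ' : ContDiff ℝ (⊤ : ℕ∞) fun y => χ y * γ y := χ.contDiff.mul hγ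
  have hc : HasCompactSupport fun y => χ y * γ y := χ.hasCompactSupport.mul_right
  have heq : ∀ x ∈ K, (fun y => χ y * γ y) =ᶠ[𝓝 (f x)] γ := by
    intro x hx
    have : f x ∈ Metric.ball (0 : Y) χ.rIn := by simpa using hs' x hx
    filter_upwards [χ.eventuallyEq_one_of_mem_ball this] with y hy
    simp [hy]
  have h1 := h.firstVariation_eq θ _ hγ' (hc.fderiv ℝ)
  rw [V.integral_weakDeriv_eq_add hγ' f h.locallyIntegrable θ, ← sub_eq_iff_eq_add'] at h1
  rw [V.derivFunctional_congr (h := (⟨_, hγ'.continuous⟩ : C(Y, ℝ)).comp f)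
    fun x hx => ((heq x hx).eq_of_nhds).symm, derivFunctional_apply]
  refine h1.trans (integral_congr_ae (.of_forall fun z => ?_))
  by_cases hz : z.1 ∈ K
  · simp only [(heq _ hz).fderiv_eq]
  · simp [θ.eq_zero_of_notMem hz]

/-- The smooth formula applied to `γ ∘ f₀` brings in `P♮`, so the derivative depends on the plane.
Keeping this dependence avoids averaging over planes before passing to a limit. -/
theorem hasChainRule_of_contDiff {f₀ : Rn n → Y} (hf₀ : ContDiff ℝ (⊤ : ℕ∞) f₀) {f : C(U, Y)}
    (hf : ∀ x : U, f x = f₀ x) :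
    V.HasChainRule f fun z => (fderiv ℝ f₀ z.1).comp z.2.proj := by
  intro γ hγ θ
  rw [V.derivFunctional_of_contDiff (hγ.comp hf₀) (fun x => by simp [hf x]) θ]
  refine integral_congr_ae (.of_forall fun z => ?_)
  simp only
  rw [fderiv_comp _ (hγ.differentiable (by simp) _) (hf₀.differentiable (by simp) _), hf]
  rfl

end Varifold

namespace Varifold

variable {n m : ℕ} {U : Opens (Rn n)} {V : Varifold m U}

/-! ### Bounds for Lipschitzian functions -/

theorem norm_proj_apply_le (P : Grass n m) (v : Rn n) : ‖P.proj v‖ ≤ ‖v‖ :=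
  (P.proj.le_opNorm v).trans (mul_le_of_le_one_left (norm_nonneg v) P.1.starProjection_norm_le)

theorem norm_proj_le (P : Grass n m) : ‖P.proj‖ ≤ 1 := P.1.starProjection_norm_le

/-- Scalar functions extend from `W` to `ℝⁿ` with the same constant, and mollification keeps it. For
the smooth approximations the bound follows from `|DG| ≤ q` and `|P♮ v| ≤ |v|`; locality and
continuity of the functional transfer it to `g`. -/
theorem abs_derivFunctional_le_of_lipschitzOnWith [IsFiniteMeasureOnCompacts V.variation]
    {g : C(U, ℝ)} {W : Set U} {q : ℝ≥0} (hg : LipschitzOnWith q g W) {φ : 𝓓(U, ℝ)}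
    (hφ : ((↑) ⁻¹' tsupport φ : Set U) ⊆ W) (v : Rn n) :
    |V.derivFunctional g (TestFunction.smulVec v φ)| ≤
      q * ‖v‖ * ∫ x : U, |φ x| ∂V.weight := by
  have hext : ∀ x : U, Function.extend (↑) g (0 : Rn n → ℝ) x = g x := fun x =>
    Subtype.val_injective.extend_apply g 0 x
  have hg' : LipschitzOnWith q (Function.extend (↑) g (0 : Rn n → ℝ)) ((↑) '' W) := by
    rintro _ ⟨x, hx, rfl⟩ _ ⟨y, hy, rfl⟩
    rw [hext, hext]
    exact hg hx hy
  obtain ⟨G, hG, hGg⟩ := hg'.extend_real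
  choose γ hγ hγL hγG using fun i : ℕ => hG.exists_contDiff_approx
    (Nat.one_div_pos_of_nat (n := i) (α := ℝ))
  let G' : C(U, ℝ) := ⟨fun x => G x, hG.continuous.comp continuous_subtype_val⟩
  let γ' : ℕ → C(U, ℝ) := fun i =>
    ⟨fun x => γ i x, (hγ i).continuous.comp continuous_subtype_val⟩
  have hsub : ((↑) ⁻¹' tsupport (TestFunction.smulVec v φ) : Set U) ⊆ (↑) ⁻¹' tsupport φ :=
    fun x hx => TestFunction.tsupport_smulVec_subset v φ hx
  have hG' : V.derivFunctional g (TestFunction.smulVec v φ) =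
      V.derivFunctional G' (TestFunction.smulVec v φ) := by
    refine V.derivFunctional_congr fun x hx => ?_
    rw [← hext]
    exact hGg ⟨x, hφ (hsub hx), rfl⟩
  obtain ⟨B, hB⟩ := φ.isCompact_preimage_tsupport.exists_bound_of_continuousOn
    G'.continuous.continuousOn
  have hlim : Tendsto (fun i => V.derivFunctional (γ' i) (TestFunction.smulVec v φ)) atTop
      (𝓝 (V.derivFunctional G' (TestFunction.smulVec v φ))) := by
    refine V.tendsto_derivFunctional (B := B + q) (.of_forall fun i x hx => ?_) fun x _ => ?_
    · have h1 := hγG i (x : Rn n)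
      have h2 : ‖γ' i x - G' x‖ ≤ q := by
        rw [← dist_eq_norm]
        refine h1.trans (mul_le_of_le_one_right q.2 ?_)
        rw [div_le_one (by positivity)]
        linarith [(Nat.cast_nonneg i : (0 : ℝ) ≤ i)]
      calc ‖γ' i x‖ = ‖G' x + (γ' i x - G' x)‖ := by rw [add_sub_cancel]
        _ ≤ B + q := (norm_add_le _ _).trans (add_le_add (hB x (hsub hx)) h2)
    · rw [tendsto_iff_dist_tendsto_zero]
      refine squeeze_zero (fun _ => dist_nonneg) (fun i => hγG i (x : Rn n)) ?_
      simpa using (tendsto_one_div_add_atTop_nhds_zero_nat (𝕜 := ℝ)).const_mul (q : ℝ)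
  rw [hG']
  refine le_of_tendsto hlim.abs (.of_forall fun i => ?_)
  rw [V.derivFunctional_of_contDiff (hγ i) (fun x => rfl), ← integral_const_mul,
    V.integral_weight (by
      exact (φ.continuous_restrict.abs.const_mul _).aestronglyMeasurable), ← Real.norm_eq_abs]
  refine norm_integral_le_of_norm_le
    (V.integrable_comp_fst ((φ.integrable_restrict V.weight).abs.const_mul _)) (.of_forall fun z => ?_)
  refine (ContinuousLinearMap.le_opNorm _ _).trans ?_
  rw [mul_assoc]
  refine mul_le_mul (norm_fderiv_le_of_lipschitz ℝ (hγL i)) ?_ (norm_nonneg _) q.2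
  refine (norm_proj_apply_le _ _).trans (le_of_eq ?_)
  rw [TestFunction.smulVec_apply, norm_smul, mul_comm, Real.norm_eq_abs]

variable {Y : Type*} [NormedAddCommGroup Y] [NormedSpace ℝ Y] [FiniteDimensional ℝ Y]

/-! ### Components of vector fields and assembly of the derivative -/

theorem eq_sum_smulVec (θ : 𝓓(U, Rn n)) :
    θ = ∑ k, TestFunction.smulVec (EuclideanSpace.single k (1 : ℝ))
      (TestFunction.postcompCLM (EuclideanSpace.proj k : Rn n →L[ℝ] ℝ) θ) := by
  ext x k
  rw [FunLike.coe_sum, Finset.sum_apply]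
  simp [Finset.sum_apply, Pi.single_apply]

/-- Representation of the distributional derivative by a locally integrable function. -/
theorem exists_locallyIntegrable_deriv [IsFiniteMeasureOnCompacts V.variation] {f : C(U, Y)}
    (hb : ∀ K : Set U, IsCompact K → ∃ C, 0 ≤ C ∧
      ∀ (φ : 𝓓(U, ℝ)) (l : Y →L[ℝ] ℝ) (v : Rn n), ((↑) ⁻¹' tsupport φ : Set U) ⊆ K →
        |V.derivFunctional ((l : C(Y, ℝ)).comp f) (TestFunction.smulVec v φ)| ≤
          C * ‖l‖ * ‖v‖ * ∫ x : U, |φ x| ∂V.weight) :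
    ∃ F : U → (Rn n →L[ℝ] Y), LocallyIntegrable F V.weight ∧
      ∀ (l : Y →L[ℝ] ℝ) (θ : 𝓓(U, Rn n)), V.derivFunctional ((l : C(Y, ℝ)).comp f) θ =
        ∫ x, l (F x (θ x)) ∂V.weight := by
  have hscalar : ∀ (l : Y →L[ℝ] ℝ) (v : Rn n), ∃ h : U → ℝ, LocallyIntegrable h V.weight ∧
      ∀ φ, V.derivFunctional ((l : C(Y, ℝ)).comp f) (TestFunction.smulVec v φ) =
        ∫ x : U, φ x * h x ∂V.weight := fun l v =>
    TestFunction.exists_locallyIntegrable_repr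
      (V.derivFunctional ((l : C(Y, ℝ)).comp f) ∘ₗ TestFunction.smulVec v) fun K hK => by
        obtain ⟨C, hC, h⟩ := hb K hK
        exact ⟨C * ‖l‖ * ‖v‖, by positivity, fun φ hφ => h φ l v hφ⟩
  choose h hhi hh using hscalar
  let b := Module.finBasis ℝ Y
  let c : Fin (Module.finrank ℝ Y) → (Y →L[ℝ] ℝ) := fun j =>
    LinearMap.toContinuousLinearMap (b.coord j)
  let E : Fin (Module.finrank ℝ Y) → Fin n → (Rn n →L[ℝ] Y) := fun j k =>
    (EuclideanSpace.proj k : Rn n →L[ℝ] ℝ).smulRight (b j)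
  have hE : ∀ j k w, E j k w = w k • b j := fun _ _ _ => rfl
  -- The matrix entries of `F`: coordinate functionals of `Y` against standard basis vectors
  -- suffice, since the functional is linear in both `l` and `θ`.
  let H : Fin (Module.finrank ℝ Y) → Fin n → U → ℝ := fun j k =>
    h (c j) (EuclideanSpace.single k 1)
  have hlF : ∀ (l : Y →L[ℝ] ℝ) (θ : 𝓓(U, Rn n)) (x : U),
      l ((∑ j, ∑ k, H j k x • E j k) (θ x)) = ∑ j, ∑ k, l (b j) * (θ x k * H j k x) := by
    intro l θ x
    simp only [sum_apply, map_sum, smul_apply, hE, map_smul, smul_eq_mul]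
    refine Finset.sum_congr rfl fun j _ => Finset.sum_congr rfl fun k _ => ?_
    ring
  refine ⟨fun x => ∑ j, ∑ k, H j k x • E j k, ?_, fun l θ => ?_⟩
  · intro x
    choose s hs hsi using fun j k => hhi (c j) (EuclideanSpace.single k 1) x
    refine ⟨⋂ j, ⋂ k, s j k, (iInter_mem.2 fun j => iInter_mem.2 fun k => hs j k), ?_⟩
    refine integrable_finsetSum _ fun j _ => integrable_finsetSum _ fun k _ => ?_
    exact ((hsi j k).mono_set ((Set.iInter_subset _ j).trans (Set.iInter_subset _ k))).smul_const _
  · have hl : (l : C(Y, ℝ)).comp f = ∑ j, l (b j) • ((c j : C(Y, ℝ)).comp f) := by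
      ext x
      have : l (f x) = l (∑ j, b.repr (f x) j • b j) := by rw [b.sum_repr]
      simp only [ContinuousMap.comp_apply, ContinuousMap.coe_sum, Finset.sum_apply,
        ContinuousMap.coe_smul, Pi.smul_apply, smul_eq_mul]
      refine this.trans ?_
      simp only [map_sum, map_smul, smul_eq_mul]
      exact Finset.sum_congr rfl fun j _ => mul_comm _ _
    have hint : ∀ j k, Integrable (fun x : U => l (b j) * (θ x k * H j k x)) V.weight :=
      fun j k => ((TestFunction.postcompCLM (EuclideanSpace.proj k : Rn n →L[ℝ] ℝ)
        θ).integrable_smul_of_locallyIntegrable (hhi _ _)).const_mul _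
    simp_rw [hlF]
    rw [integral_finsetSum _ fun j _ => integrable_finsetSum _ fun k _ => hint j k, hl, map_sum,
      LinearMap.sum_apply]
    refine Finset.sum_congr rfl fun j _ => ?_
    rw [integral_finsetSum _ fun k _ => hint j k, map_smul, LinearMap.smul_apply]
    conv_lhs => rw [eq_sum_smulVec θ]
    rw [map_sum, Finset.smul_sum]
    refine Finset.sum_congr rfl fun k _ => ?_
    rw [hh, integral_const_mul]
    rfl

/-! ### Weak convergence -/

/-- With a uniform essential bound on the `d i`, weak convergence against test functions extends to
integrable `ψ` by density in `L₁(‖V‖)`. The factors `d i` may depend on the plane, whereas `ψ` may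
not. -/
theorem tendsto_integral_mul_of_test {d : ℕ → U × Grass n m → ℝ} {d' : U × Grass n m → ℝ} {M : ℝ}
    (hdm : ∀ i, AEStronglyMeasurable (d i) V.measure) (hd : ∀ i, ∀ᵐ z ∂V.measure, ‖d i z‖ ≤ M)
    (hdm' : AEStronglyMeasurable d' V.measure) (hd' : ∀ᵐ z ∂V.measure, ‖d' z‖ ≤ M)
    (ht : ∀ φ : 𝓓(U, ℝ), Tendsto (fun i => ∫ z : U × Grass n m, φ z.1 * d i z ∂V.measure) atTop
      (𝓝 (∫ z : U × Grass n m, φ z.1 * d' z ∂V.measure)))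
    {ψ : U → ℝ} (hψ : Integrable ψ V.weight) :
    Tendsto (fun i => ∫ z : U × Grass n m, ψ z.1 * d i z ∂V.measure) atTop
      (𝓝 (∫ z : U × Grass n m, ψ z.1 * d' z ∂V.measure)) := by
  have hclose : ∀ (φ : 𝓓(U, ℝ)) (e : U × Grass n m → ℝ), AEStronglyMeasurable e V.measure →
      (∀ᵐ z ∂V.measure, ‖e z‖ ≤ M) →
      |∫ z : U × Grass n m, ψ z.1 * e z ∂V.measure - ∫ z : U × Grass n m, φ z.1 * e z ∂V.measure| ≤
        |M| * ∫ x : U, ‖ψ x - φ x‖ ∂V.weight := by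
    intro φ e hem he
    have hi1 := (V.integrable_comp_fst hψ).mul_bdd hem he
    have hi2 := (V.integrable_comp_fst (φ.integrable_restrict V.weight)).mul_bdd hem he
    have hi3 : Integrable (fun x : U => ψ x - φ x) V.weight := hψ.sub (φ.integrable_restrict V.weight)
    rw [← integral_sub hi1 hi2, ← integral_const_mul, V.integral_weight
      (hi3.norm.const_mul _).aestronglyMeasurable, ← Real.norm_eq_abs]
    refine norm_integral_le_of_norm_le (V.integrable_comp_fst (hi3.norm.const_mul _)) ?_
    filter_upwards [he] with z hz
    rw [← sub_mul, norm_mul, mul_comm]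
    exact mul_le_mul_of_nonneg_right (hz.trans (le_abs_self M)) (norm_nonneg _)
  rw [Metric.tendsto_atTop]
  intro ε hε
  obtain ⟨φ, hφ⟩ := TestFunction.exists_eLpNorm_sub_le ENNReal.one_ne_top le_rfl
    (memLp_one_iff_integrable.2 hψ) (ε := ENNReal.ofReal (ε / (4 * (|M| + 1))))
    (by rw [ne_eq, ENNReal.ofReal_eq_zero, not_le]; positivity)
  have hφ' : |M| * ∫ x : U, ‖ψ x - φ x‖ ∂V.weight ≤ ε / 4 := by
    have hi3 : Integrable (fun x : U => ψ x - φ x) V.weight := hψ.sub (φ.integrable_restrict V.weight)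
    have h1 : ∫ x : U, ‖ψ x - φ x‖ ∂V.weight ≤ ε / (4 * (|M| + 1)) := by
      rw [eLpNorm_one_eq_lintegral_enorm] at hφ
      exact (integral_norm_eq_lintegral_enorm hi3.1).le.trans
        (ENNReal.toReal_le_of_le_ofReal (by positivity) hφ)
    calc |M| * ∫ x : U, ‖ψ x - φ x‖ ∂V.weight ≤ |M| * (ε / (4 * (|M| + 1))) := by gcongr
      _ = ε / 4 * (|M| / (|M| + 1)) := by field_simp
      _ ≤ ε / 4 := mul_le_of_le_one_right (by positivity)
          ((div_le_one (by positivity)).2 (by linarith))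
  obtain ⟨N, hN⟩ := Metric.tendsto_atTop.1 (ht φ) (ε / 4) (by positivity)
  refine ⟨N, fun i hi => ?_⟩
  have h1 := (hclose φ (d i) (hdm i) (hd i)).trans hφ'
  have h2 := (hclose φ d' hdm' hd').trans hφ'
  have h3 := hN i hi
  rw [Real.dist_eq] at h3 ⊢
  rw [abs_le] at h1 h2
  rw [abs_lt] at h3 ⊢
  constructor <;> linarith

/-- Expanding in a basis of the finite dimensional space `Hom(ℝⁿ, Y)` reduces this to finitely many
scalar limits. -/
theorem tendsto_integral_clm_of_test {D : ℕ → U × Grass n m → (Rn n →L[ℝ] Y)}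
    {D' : U × Grass n m → (Rn n →L[ℝ] Y)} {M : ℝ}
    (hDm : ∀ i, AEStronglyMeasurable (D i) V.measure) (hD : ∀ i, ∀ᵐ z ∂V.measure, ‖D i z‖ ≤ M)
    (hDm' : AEStronglyMeasurable D' V.measure) (hD' : ∀ᵐ z ∂V.measure, ‖D' z‖ ≤ M)
    (ht : ∀ (φ : 𝓓(U, ℝ)) (l : Y →L[ℝ] ℝ) (v : Rn n),
      Tendsto (fun i => ∫ z : U × Grass n m, φ z.1 * l (D i z v) ∂V.measure) atTop
        (𝓝 (∫ z : U × Grass n m, φ z.1 * l (D' z v) ∂V.measure)))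
    {A : U → ((Rn n →L[ℝ] Y) →L[ℝ] ℝ)} (hA : Integrable A V.weight) :
    Tendsto (fun i => ∫ z : U × Grass n m, A z.1 (D i z) ∂V.measure) atTop
      (𝓝 (∫ z : U × Grass n m, A z.1 (D' z) ∂V.measure)) := by
  let b := Module.finBasis ℝ Y
  let c : Fin (Module.finrank ℝ Y) → (Y →L[ℝ] ℝ) := fun j =>
    LinearMap.toContinuousLinearMap (b.coord j)
  let E : Fin (Module.finrank ℝ Y) → Fin n → (Rn n →L[ℝ] Y) := fun j k =>
    (EuclideanSpace.proj k : Rn n →L[ℝ] ℝ).smulRight (b j)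
  have hE : ∀ j k w, E j k w = w k • b j := fun _ _ _ => rfl
  let e : Fin n → Rn n := fun k => EuclideanSpace.single k 1
  have hexp : ∀ H : Rn n →L[ℝ] Y, H = ∑ j, ∑ k, c j (H (e k)) • E j k := by
    intro H
    refine ContinuousLinearMap.coe_injective
      ((EuclideanSpace.basisFun (Fin n) ℝ).toBasis.ext fun i => ?_)
    have h1 : ∑ j, c j (H (e i)) • b j = H (e i) := b.sum_repr _
    simp only [OrthonormalBasis.coe_toBasis, EuclideanSpace.basisFun_apply,
      ContinuousLinearMap.coe_coe, sum_apply, smul_apply, hE]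
    rw [← h1]
    refine Finset.sum_congr rfl fun j _ => ?_
    rw [Finset.sum_eq_single i]
    · simp
    · intro k _ hk
      simp [hk]
    · simp
  have hAexp : ∀ (x : U) (H : Rn n →L[ℝ] Y), A x H = ∑ j, ∑ k, A x (E j k) * c j (H (e k)) := by
    intro x H
    conv_lhs => rw [hexp H]
    simp only [map_sum, map_smul, smul_eq_mul]
    exact Finset.sum_congr rfl fun j _ => Finset.sum_congr rfl fun k _ => mul_comm _ _
  have hAi : ∀ j k, Integrable (fun x => A x (E j k)) V.weight := fun j k =>
    (ContinuousLinearMap.apply ℝ ℝ (E j k)).integrable_comp hA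
  have hbd : ∀ (j : Fin (Module.finrank ℝ Y)) (k : Fin n) (H : Rn n →L[ℝ] Y), ‖H‖ ≤ M →
      ‖c j (H (e k))‖ ≤ ‖c j‖ * M := by
    intro j k H hH
    refine ((c j).le_opNorm _).trans (mul_le_mul_of_nonneg_left ?_ (norm_nonneg _))
    refine (H.le_opNorm _).trans ?_
    simpa [e] using hH
  have hmeas : ∀ (j : Fin (Module.finrank ℝ Y)) (k : Fin n) (H : U × Grass n m → (Rn n →L[ℝ] Y)),
      AEStronglyMeasurable H V.measure →
      AEStronglyMeasurable (fun z => c j (H z (e k))) V.measure := fun j k H hH =>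
    ((c j).comp (ContinuousLinearMap.apply ℝ Y (e k))).continuous.comp_aestronglyMeasurable hH
  have hsum : ∀ H : U × Grass n m → (Rn n →L[ℝ] Y), AEStronglyMeasurable H V.measure →
      (∀ᵐ z ∂V.measure, ‖H z‖ ≤ M) → ∫ z : U × Grass n m, A z.1 (H z) ∂V.measure =
        ∑ j, ∑ k, ∫ z : U × Grass n m, A z.1 (E j k) * c j (H z (e k)) ∂V.measure := by
    intro H hHm hH
    have hi : ∀ j k, Integrable (fun z : U × Grass n m => A z.1 (E j k) * c j (H z (e k)))
        V.measure := fun j k =>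
      (V.integrable_comp_fst (hAi j k)).mul_bdd (hmeas j k H hHm) (hH.mono fun z hz => hbd j k _ hz)
    rw [integral_congr_ae (.of_forall fun z : U × Grass n m => hAexp z.1 (H z))]
    rw [integral_finsetSum _ fun j _ => integrable_finsetSum _ fun k _ => hi j k]
    exact Finset.sum_congr rfl fun j _ => integral_finsetSum _ fun k _ => hi j k
  rw [hsum D' hDm' hD']
  simp_rw [fun i => hsum (D i) (hDm i) (hD i)]
  refine tendsto_finsetSum _ fun j _ => tendsto_finsetSum _ fun k _ => ?_
  exact tendsto_integral_mul_of_test (fun i => hmeas j k _ (hDm i))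
    (fun i => (hD i).mono fun z hz => hbd j k _ hz) (hmeas j k _ hDm')
    (hD'.mono fun z hz => hbd j k _ hz) (fun φ => ht φ (c j) (e k)) (hAi j k)

end Varifold

/-! ### Derivatives characterised by linear functionals -/

namespace Varifold

variable {n m : ℕ} {U : Opens (Rn n)} {V : Varifold m U} [IsFiniteMeasureOnCompacts V.variation]
  {Y : Type*} [NormedAddCommGroup Y] [NormedSpace ℝ Y]

variable (V) in
/-- `F` is locally integrable and represents the distributional derivative of the continuous
function `f`, tested with linear functionals on `Y`. -/
structure HasLinearDeriv (f : C(U, Y)) (F : U → (Rn n →L[ℝ] Y)) : Prop where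
  locallyIntegrable : LocallyIntegrable F V.weight
  eq_integral : ∀ (l : Y →L[ℝ] ℝ) (θ : 𝓓(U, Rn n)),
    V.derivFunctional ((l : C(Y, ℝ)).comp f) θ =
      ∫ z : U × Grass n m, l (F z.1 (θ z.1)) ∂V.measure

theorem HasChainRule.hasLinearDeriv {f : C(U, Y)} {F : U → (Rn n →L[ℝ] Y)}
    (h : V.HasChainRule f fun z => F z.1) (hF : LocallyIntegrable F V.weight) :
    V.HasLinearDeriv f F :=
  ⟨hF, h.linear⟩

theorem abs_derivFunctional_comp_le {f : C(U, Y)} {W : Set U} {q : ℝ≥0} (hf : LipschitzOnWith q f W)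
    (φ : 𝓓(U, ℝ)) (l : Y →L[ℝ] ℝ) (v : Rn n) (hφ : ((↑) ⁻¹' tsupport φ : Set U) ⊆ W) :
    |V.derivFunctional ((l : C(Y, ℝ)).comp f) (TestFunction.smulVec v φ)| ≤
      q * ‖l‖ * ‖v‖ * ∫ x : U, |φ x| ∂V.weight := by
  have h : LipschitzOnWith (‖l‖₊ * q) ((l : C(Y, ℝ)).comp f) W := l.lipschitz.comp_lipschitzOnWith hf
  refine (abs_derivFunctional_le_of_lipschitzOnWith h hφ v).trans (le_of_eq ?_)
  push_cast
  ring

namespace HasLinearDeriv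

variable {f g : C(U, Y)} {F G : U → (Rn n →L[ℝ] Y)}

theorem eq_integral_smulVec (h : V.HasLinearDeriv f F) (l : Y →L[ℝ] ℝ) (v : Rn n) (φ : 𝓓(U, ℝ)) :
    V.derivFunctional ((l : C(Y, ℝ)).comp f) (TestFunction.smulVec v φ) =
      ∫ x : U, φ x * l (F x v) ∂V.weight := by
  rw [h.eq_integral, V.integral_weight]
  · simp
  · exact φ.continuous_restrict.aestronglyMeasurable.mul
      ((l.comp (ContinuousLinearMap.apply ℝ Y v)).continuous.comp_aestronglyMeasurable
        h.locallyIntegrable.aestronglyMeasurable)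

variable [FiniteDimensional ℝ Y]

theorem ae_norm_le (h : V.HasLinearDeriv f F) {W : Set U} (hW : IsOpen W) {L : ℝ} (hL : 0 ≤ L)
    (hb : ∀ (φ : 𝓓(U, ℝ)) (l : Y →L[ℝ] ℝ) (v : Rn n), ((↑) ⁻¹' tsupport φ : Set U) ⊆ W →
      |V.derivFunctional ((l : C(Y, ℝ)).comp f) (TestFunction.smulVec v φ)| ≤
        L * ‖l‖ * ‖v‖ * ∫ x : U, |φ x| ∂V.weight) :
    ∀ᵐ x ∂V.weight, x ∈ W → ‖F x‖ ≤ L :=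
  TestFunction.ae_opNorm_le_of_integral_le hW h.locallyIntegrable hL fun φ l v hφ => by
    rw [← h.eq_integral_smulVec]
    exact hb φ l v hφ

/-- By locality `F - G` tests to zero in `W`, so the operator norm bound applies with `L = 0`. -/
theorem ae_eq (hf : V.HasLinearDeriv f F) (hg : V.HasLinearDeriv g G) {W : Set U} (hW : IsOpen W)
    (hfg : Set.EqOn f g W) : ∀ᵐ x ∂V.weight, x ∈ W → F x = G x := by
  have key := TestFunction.ae_opNorm_le_of_integral_le hW
    (hf.locallyIntegrable.sub hg.locallyIntegrable) le_rfl fun φ l v hφ => by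
      have hi : ∀ {H : U → (Rn n →L[ℝ] Y)}, LocallyIntegrable H V.weight →
          Integrable (fun x : U => φ x * l (H x v)) V.weight := fun {H} hH =>
        φ.integrable_smul_of_locallyIntegrable (h := fun x => l (H x v)) fun x =>
          let ⟨s, hs, hsi⟩ := hH x
          ⟨s, hs, (l.comp (ContinuousLinearMap.apply ℝ Y v)).integrable_comp hsi⟩
      have h1 : ∀ x : U, φ x * l ((F - G) x v) = φ x * l (F x v) - φ x * l (G x v) := fun x => by
        simp [mul_sub]
      simp_rw [h1]
      rw [integral_sub (hi hf.locallyIntegrable) (hi hg.locallyIntegrable),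
        ← hf.eq_integral_smulVec, ← hg.eq_integral_smulVec, V.derivFunctional_congr
          (h := (l : C(Y, ℝ)).comp g) fun x hx => by
            have hxW := hφ (TestFunction.tsupport_smulVec_subset v φ hx)
            simp [hfg hxW]]
      simp
  filter_upwards [key] with x hx hxW
  exact sub_eq_zero.1 (norm_le_zero_iff.1 (hx hxW))

end HasLinearDeriv

variable [FiniteDimensional ℝ Y]

theorem IsWeakDeriv.hasLinearDeriv {f : C(U, Y)} {F : U → (Rn n →L[ℝ] Y)}
    (h : V.IsWeakDeriv f F) : V.HasLinearDeriv f F :=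
  h.hasChainRule.hasLinearDeriv h.locallyIntegrable

theorem exists_hasLinearDeriv {f : C(U, Y)}
    (hb : ∀ K : Set U, IsCompact K → ∃ C, 0 ≤ C ∧
      ∀ (φ : 𝓓(U, ℝ)) (l : Y →L[ℝ] ℝ) (v : Rn n), ((↑) ⁻¹' tsupport φ : Set U) ⊆ K →
        |V.derivFunctional ((l : C(Y, ℝ)).comp f) (TestFunction.smulVec v φ)| ≤
          C * ‖l‖ * ‖v‖ * ∫ x : U, |φ x| ∂V.weight) :
    ∃ F : U → (Rn n →L[ℝ] Y), V.HasLinearDeriv f F := by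
  obtain ⟨F, hF, h⟩ := exists_locallyIntegrable_deriv hb
  refine ⟨F, hF, fun l θ => ?_⟩
  rw [h l θ]
  exact V.integral_weight (l.continuous.comp_aestronglyMeasurable
    ((ContinuousLinearMap.id ℝ (Rn n →L[ℝ] Y)).aestronglyMeasurable_comp₂
      hF.aestronglyMeasurable θ.continuous_restrict.aestronglyMeasurable))

/-! ### Passage to the limit -/

section Limit

variable {f : ℕ → C(U, Y)} {f' : C(U, Y)} {D : ℕ → U × Grass n m → (Rn n →L[ℝ] Y)} {M : ℝ}
  {F : U → (Rn n →L[ℝ] Y)}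

theorem tendsto_derivFunctional_comp
    (hf : ∀ K, IsCompact K → TendstoUniformlyOn (fun i x => f i x) f' atTop K) {γ : Y → ℝ}
    (hγ : Continuous γ) (θ : 𝓓(U, Rn n)) :
    Tendsto (fun i => V.derivFunctional ((⟨γ, hγ⟩ : C(Y, ℝ)).comp (f i)) θ) atTop
      (𝓝 (V.derivFunctional ((⟨γ, hγ⟩ : C(Y, ℝ)).comp f') θ)) := by
  have : ProperSpace Y := FiniteDimensional.proper_real _
  have hu := hf _ θ.isCompact_preimage_tsupport
  obtain ⟨B, hB⟩ := exists_eventually_norm_comp_le hγ θ.isCompact_preimage_tsupport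
    f'.continuous.continuousOn hu
  exact V.tendsto_derivFunctional hB fun x hx => (hγ.tendsto _).comp (hu.tendsto_at hx)

/-- Testing `D i` with `φ`, `l` and `v` gives the functional of `l ∘ f i` at `φv`, which converges
because `f i` does. Plane dependence thus disappears in the limit against coefficients depending on
`x` alone. -/
theorem tendsto_integral_clm_of_hasChainRule
    (hf : ∀ K, IsCompact K → TendstoUniformlyOn (fun i x => f i x) f' atTop K)
    (hDm : ∀ i, AEStronglyMeasurable (D i) V.measure) (hD : ∀ i, ∀ᵐ z ∂V.measure, ‖D i z‖ ≤ M)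
    (hch : ∀ i, V.HasChainRule (f i) (D i)) (hF : V.HasLinearDeriv f' F)
    (hFb : ∀ᵐ x ∂V.weight, ‖F x‖ ≤ M) {A : U → ((Rn n →L[ℝ] Y) →L[ℝ] ℝ)}
    (hA : Integrable A V.weight) :
    Tendsto (fun i => ∫ z : U × Grass n m, A z.1 (D i z) ∂V.measure) atTop
      (𝓝 (∫ z : U × Grass n m, A z.1 (F z.1) ∂V.measure)) := by
  refine tendsto_integral_clm_of_test (D' := fun z => F z.1) hDm hD
    (hF.locallyIntegrable.aestronglyMeasurable.comp_quasiMeasurePreserving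
      V.quasiMeasurePreserving_fst)
    (V.quasiMeasurePreserving_fst.ae hFb) (fun φ l v => ?_) hA
  have h1 := tendsto_derivFunctional_comp (V := V) hf l.continuous (TestFunction.smulVec v φ)
  have h2 : ∀ i, V.derivFunctional ((⟨l, l.continuous⟩ : C(Y, ℝ)).comp (f i))
      (TestFunction.smulVec v φ) = ∫ z : U × Grass n m, φ z.1 * l (D i z v) ∂V.measure := by
    intro i
    refine ((hch i).linear l (TestFunction.smulVec v φ)).trans ?_
    simp
  have h3 : V.derivFunctional ((⟨l, l.continuous⟩ : C(Y, ℝ)).comp f')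
      (TestFunction.smulVec v φ) = ∫ z : U × Grass n m, φ z.1 * l (F z.1 v) ∂V.measure := by
    refine (hF.eq_integral l (TestFunction.smulVec v φ)).trans ?_
    simp
  simpa only [h2, h3] using h1

/-- A product of a strongly and a weakly convergent factor: `Dγ(f i)` converges pointwise and
boundedly on the support of `θ`, and `D i` converges weakly with a uniform bound. -/
theorem hasChainRule_of_tendsto
    (hf : ∀ K, IsCompact K → TendstoUniformlyOn (fun i x => f i x) f' atTop K)
    (hDm : ∀ i, AEStronglyMeasurable (D i) V.measure) (hD : ∀ i, ∀ᵐ z ∂V.measure, ‖D i z‖ ≤ M)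
    (hch : ∀ i, V.HasChainRule (f i) (D i)) (hF : V.HasLinearDeriv f' F)
    (hFb : ∀ᵐ x ∂V.weight, ‖F x‖ ≤ M) : V.HasChainRule f' fun z => F z.1 := by
  intro γ hγ θ
  have : ProperSpace Y := FiniteDimensional.proper_real _
  have hcf : ∀ g : C(U, Y), Continuous (chainCoeff γ g θ) := fun g =>
    continuous_chainCoeff hγ g.continuous θ
  have hci : ∀ g : C(U, Y), Integrable (chainCoeff γ g θ) V.weight := fun g =>
    (hcf g).integrable_of_hasCompactSupport (hasCompactSupport_chainCoeff γ g θ)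
  have hu := hf _ θ.isCompact_preimage_tsupport
  have hγ' : Continuous (fderiv ℝ γ) := hγ.continuous_fderiv (by simp)
  obtain ⟨B, hB⟩ := exists_eventually_norm_comp_le hγ' θ.isCompact_preimage_tsupport
    f'.continuous.continuousOn hu
  have h1 := tendsto_derivFunctional_comp (V := V) hf hγ.continuous θ
  have h2 := tendsto_integral_clm_of_hasChainRule hf hDm hD hch hF hFb (hci f')
  have hi : ∀ (g : C(U, Y)) i, Integrable (fun z : U × Grass n m => chainCoeff γ g θ z.1 (D i z))
      V.measure := fun g i => by
    refine ((V.integrable_comp_fst (hci g)).norm.mul_const M).mono'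
      ((ContinuousLinearMap.id ℝ ((Rn n →L[ℝ] Y) →L[ℝ] ℝ)).aestronglyMeasurable_comp₂
        ((hcf g).comp continuous_fst).aestronglyMeasurable (hDm i)) ?_
    filter_upwards [hD i] with z hz
    exact ((chainCoeff γ g θ z.1).le_opNorm _).trans
      (mul_le_mul_of_nonneg_left hz (norm_nonneg _))
  -- The bound on `D i` permits replacing the coefficient built from `f i` by the one built from
  -- `f'`, a fixed integrable function of `x` to which weak convergence applies.
  have h3 : Tendsto (fun i => ∫ z : U × Grass n m,
      (chainCoeff γ (f i) θ z.1 (D i z) - chainCoeff γ f' θ z.1 (D i z)) ∂V.measure) atTop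
      (𝓝 0) := by
    have hDall : ∀ᵐ z ∂V.measure, ∀ i, ‖D i z‖ ≤ M := ae_all_iff.2 hD
    have hle : ∀ (i : ℕ) (z : U × Grass n m), ‖D i z‖ ≤ M →
        ‖chainCoeff γ (f i) θ z.1 (D i z) - chainCoeff γ f' θ z.1 (D i z)‖ ≤
          ‖fderiv ℝ γ (f i z.1) - fderiv ℝ γ (f' z.1)‖ * (M * ‖θ z.1‖) := by
      intro i z hz
      rw [chainCoeff_apply, chainCoeff_apply, ← sub_apply]
      refine (ContinuousLinearMap.le_opNorm _ _).trans (mul_le_mul_of_nonneg_left ?_ (norm_nonneg _))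
      exact ((D i z).le_opNorm _).trans (mul_le_mul_of_nonneg_right hz (norm_nonneg _))
    have hB' : ∀ x ∈ ((↑) ⁻¹' tsupport θ : Set U), ‖fderiv ℝ γ (f' x)‖ ≤ B := fun x hx =>
      le_of_tendsto ((hγ'.tendsto _).comp (hu.tendsto_at hx)).norm (hB.mono fun i h => h x hx)
    rw [← integral_zero (U × Grass n m) ℝ (μ := V.measure)]
    refine tendsto_integral_filter_of_dominated_convergence
      (fun z : U × Grass n m => (B + B) * (M * ‖θ z.1‖))
      (.of_forall fun i => ((hi (f i) i).sub (hi f' i)).1) (hB.mono fun i hBi => ?_)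
      (((V.integrable_comp_fst (θ.integrable_restrict V.weight)).norm.const_mul M).const_mul _) ?_
    · filter_upwards [hDall] with z hz
      by_cases hzK : z.1 ∈ ((↑) ⁻¹' tsupport θ : Set U)
      · refine (hle i z (hz i)).trans (mul_le_mul_of_nonneg_right ?_
          (mul_nonneg ((norm_nonneg _).trans (hz 0)) (norm_nonneg _)))
        exact (norm_sub_le _ _).trans (add_le_add (hBi _ hzK) (hB' _ hzK))
      · simp [θ.eq_zero_of_notMem hzK]
    · filter_upwards [hDall] with z hz
      by_cases hzK : z.1 ∈ ((↑) ⁻¹' tsupport θ : Set U)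
      · refine squeeze_zero_norm (fun i => hle i z (hz i)) ?_
        have h4 := ((hγ'.tendsto _).comp (hu.tendsto_at hzK)).sub_const (fderiv ℝ γ (f' z.1))
        rw [sub_self] at h4
        simpa using h4.norm.mul_const (M * ‖θ z.1‖)
      · simp [θ.eq_zero_of_notMem hzK]
  refine tendsto_nhds_unique h1 ?_
  have h5 := h3.add h2
  rw [zero_add] at h5
  refine h5.congr fun i => ?_
  rw [integral_sub (hi (f i) i) (hi f' i), sub_add_cancel, hch i γ hγ θ]
  rfl

end Limit

/-! ### Locally Lipschitzian functions -/

theorem HasLinearDeriv.ae_norm_le_of_lipschitzOnWith {f : C(U, Y)} {F : U → (Rn n →L[ℝ] Y)}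
    (h : V.HasLinearDeriv f F) {W : Set U} (hW : IsOpen W) {q : ℝ≥0} (hf : LipschitzOnWith q f W) :
    ∀ᵐ x ∂V.weight, x ∈ W → ‖F x‖ ≤ q :=
  h.ae_norm_le hW q.2 (abs_derivFunctional_comp_le hf)

theorem _root_.LocallyLipschitz.exists_lipschitzOnWith_isOpen {X Z : Type*} [PseudoMetricSpace X]
    [WeaklyLocallyCompactSpace X] [PseudoMetricSpace Z] {f : X → Z} (hf : LocallyLipschitz f)
    {K : Set X} (hK : IsCompact K) :
    ∃ W, IsOpen W ∧ K ⊆ W ∧ ∃ q, LipschitzOnWith q f W := by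
  obtain ⟨L, hL, hKL⟩ := exists_compact_superset hK
  obtain ⟨q, hq⟩ := hf.locallyLipschitzOn.exists_lipschitzOnWith_of_compact hL
  exact ⟨interior L, isOpen_interior, hKL, q, hq.mono interior_subset⟩

/-- The density `F` comes from the linear bounds. Mollifications of `f₀` satisfy the chain rule with
derivatives bounded by the same `q` as `F`, so the limit theorem applies. -/
theorem exists_hasChainRule_of_lipschitzWith {f₀ : Rn n → Y} {q : ℝ≥0} (hf₀ : LipschitzWith q f₀)
    {f : C(U, Y)} (hf : ∀ x : U, f x = f₀ x) :
    ∃ F : U → (Rn n →L[ℝ] Y), V.HasLinearDeriv f F ∧ V.HasChainRule f fun z => F z.1 := by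
  have hfL : LipschitzOnWith q f Set.univ := by
    intro x _ y _
    rw [hf, hf]
    exact hf₀ x y
  obtain ⟨F, hF⟩ := exists_hasLinearDeriv (V := V) (f := f) fun K _ =>
    ⟨q, q.2, fun φ l v _ => abs_derivFunctional_comp_le hfL φ l v (Set.subset_univ _)⟩
  have hFb := hF.ae_norm_le_of_lipschitzOnWith isOpen_univ hfL
  choose g hg hgL hgf using fun i : ℕ => hf₀.exists_contDiff_approx
    (Nat.one_div_pos_of_nat (n := i) (α := ℝ))
  let g' : ℕ → C(U, Y) := fun i =>
    ⟨fun x => g i x, (hg i).continuous.comp continuous_subtype_val⟩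
  refine ⟨F, hF, hasChainRule_of_tendsto (f := g') (M := q) (fun K _ => ?_)
    (D := fun i z => (fderiv ℝ (g i) z.1).comp z.2.proj) (fun i => ?_)
    (fun i => .of_forall fun z => ?_) (fun i => hasChainRule_of_contDiff (hg i) fun _ => rfl) hF
    (hFb.mono fun x hx => hx trivial)⟩
  · rw [Metric.tendstoUniformlyOn_iff]
    intro ε hε
    have h := (tendsto_one_div_add_atTop_nhds_zero_nat (𝕜 := ℝ)).const_mul (q : ℝ)
    rw [mul_zero] at h
    filter_upwards [(tendsto_order.1 h).2 ε hε] with i hi x _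
    rw [hf, dist_comm]
    exact (hgf i _).trans_lt hi
  · exact ((((hg i).continuous_fderiv (by simp)).comp
      (continuous_subtype_val.comp continuous_fst)).clm_comp
        ((Grass.isInducing_proj n m).continuous.comp continuous_snd)).aestronglyMeasurable
  · refine (ContinuousLinearMap.opNorm_comp_le _ _).trans ?_
    exact (mul_le_of_le_one_right (norm_nonneg _) (norm_proj_le _)).trans
      (norm_fderiv_le_of_lipschitz ℝ (hgL i))

/-- The density exists globally because only local bounds are needed. The chain rule is checked for
each `θ` by replacing `f`, near the support, by a Lipschitzian map on `ℝⁿ` whose derivative agrees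
there almost everywhere by locality. -/
theorem exists_isWeakDeriv_of_locallyLipschitz {f : C(U, Y)} (hf : LocallyLipschitz f) :
    ∃ F : U → (Rn n →L[ℝ] Y), V.IsWeakDeriv f F := by
  obtain ⟨F, hF⟩ := exists_hasLinearDeriv (V := V) (f := f) fun K hK => by
    obtain ⟨W, -, hKW, q, hq⟩ := hf.exists_lipschitzOnWith_isOpen hK
    exact ⟨q, q.2, fun φ l v hφ => abs_derivFunctional_comp_le hq φ l v (hφ.trans hKW)⟩
  refine ⟨F, isWeakDeriv_of_hasChainRule hF.locallyIntegrable fun γ hγ θ => ?_⟩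
  obtain ⟨W, hW, hθW, q, hq⟩ := hf.exists_lipschitzOnWith_isOpen θ.isCompact_preimage_tsupport
  have hext : ∀ x : U, Function.extend (↑) f (0 : Rn n → Y) x = f x := fun x =>
    Subtype.val_injective.extend_apply f 0 x
  have hq' : LipschitzOnWith q (Function.extend (↑) f (0 : Rn n → Y)) ((↑) '' W) := by
    rintro _ ⟨x, hx, rfl⟩ _ ⟨y, hy, rfl⟩
    rw [hext, hext]
    exact hq hx hy
  -- Extension of a vector-valued map may enlarge the constant; this is harmless, as its size plays
  -- no role in the chain rule.
  obtain ⟨g₀, hg₀, hg₀f⟩ := hq'.extend_finite_dimension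
  let g : C(U, Y) := ⟨fun x => g₀ x, hg₀.continuous.comp continuous_subtype_val⟩
  obtain ⟨G, hG, hGc⟩ := exists_hasChainRule_of_lipschitzWith (V := V) hg₀ (f := g) fun _ => rfl
  have hfg : Set.EqOn f g W := fun x hx => by
    rw [← hext]
    exact hg₀f ⟨x, hx, rfl⟩
  rw [V.derivFunctional_congr (h := (⟨γ, hγ.continuous⟩ : C(Y, ℝ)).comp g)
    fun x hx => by simp [hfg (hθW hx)], hGc γ hγ θ]
  refine integral_congr_ae ?_
  filter_upwards [V.quasiMeasurePreserving_fst.ae (hF.ae_eq hG hW hfg)] with z hz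
  by_cases hzK : z.1 ∈ ((↑) ⁻¹' tsupport θ : Set U)
  · simp only [hz (hθW hzK), hfg (hθW hzK)]
  · simp [θ.eq_zero_of_notMem hzK]

theorem _root_.lipConst_mono {X Z : Type*} [PseudoEMetricSpace X] [PseudoEMetricSpace Z] (f : X → Z)
    {s t : Set X} (h : s ⊆ t) : lipConst f s ≤ lipConst f t :=
  iInf_mono fun _ => iInf_mono' fun hK => ⟨hK.mono h, le_rfl⟩

/-- The weak derivative is bounded by the local Lipschitz constant. -/
theorem HasLinearDeriv.ae_enorm_le_lipConst {f : C(U, Y)} {F : U → (Rn n →L[ℝ] Y)}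
    (h : V.HasLinearDeriv f F) :
    ∀ᵐ x ∂V.weight, ∀ r : ℝ, 0 < r → ‖F x‖ₑ ≤ lipConst f (Metric.closedBall x r) := by
  -- Countably many open sets and rational constants give a single null set, valid for all radii and
  -- all Lipschitz constants at once.
  have hall : ∀ᵐ x ∂V.weight, ∀ W ∈ countableBasis U, ∀ q : ℚ, 0 ≤ q →
      LipschitzOnWith (q : ℝ).toNNReal f W → x ∈ W → ‖F x‖ ≤ (q : ℝ).toNNReal := by
    refine (ae_ball_iff (countable_countableBasis U)).2 fun W hW => ae_all_iff.2 fun q => ?_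
    by_cases hq : LipschitzOnWith (q : ℝ).toNNReal f W
    · filter_upwards [h.ae_norm_le_of_lipschitzOnWith (isOpen_of_mem_countableBasis hW) hq]
        with x hx _ _ using hx
    · exact .of_forall fun x _ h' => absurd h' hq
  filter_upwards [hall] with x hx r hr
  refine le_iInf₂ fun K hK => ?_
  obtain ⟨W, hW, hxW, hWr⟩ := (isBasis_countableBasis U).exists_subset_of_mem_open
    (Metric.mem_ball_self hr) Metric.isOpen_ball
  have hK' : ‖F x‖ ≤ K := by
    refine le_of_forall_gt_imp_ge_of_dense fun a ha => ?_
    obtain ⟨q, hKq, hqa⟩ := exists_rat_btwn ha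
    have hq0 : (0 : ℝ) ≤ q := K.2.trans hKq.le
    have hKq' : K ≤ (q : ℝ).toNNReal := by
      rw [← NNReal.coe_le_coe, Real.coe_toNNReal _ hq0]
      exact hKq.le
    have h1 := hx W hW q (by exact_mod_cast hq0)
      ((hK.mono (hWr.trans Metric.ball_subset_closedBall)).weaken hKq') hxW
    rw [Real.coe_toNNReal _ hq0] at h1
    exact h1.trans hqa.le
  rw [← ofReal_norm, ← ENNReal.ofReal_coe_nnreal]
  exact ENNReal.ofReal_le_ofReal hK'

end Varifold

namespace Varifold

variable {n m : ℕ} {U : Opens (Rn n)} {V : Varifold m U} [IsFiniteMeasureOnCompacts V.variation]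
  {Y : Type*} [NormedAddCommGroup Y] [NormedSpace ℝ Y] [FiniteDimensional ℝ Y]

/-- A uniform bound for weak derivatives passes to locally uniform limits. -/
theorem abs_derivFunctional_le_of_tendsto {f : ℕ → C(U, Y)} {f' : C(U, Y)}
    {F : ℕ → U → (Rn n →L[ℝ] Y)} {M : ℝ}
    (hf : ∀ K, IsCompact K → TendstoUniformlyOn (fun i x => f i x) f' atTop K)
    (hF : ∀ i, V.HasLinearDeriv (f i) (F i)) (hFb : ∀ i, ∀ᵐ x ∂V.weight, ‖F i x‖ ≤ M)
    (φ : 𝓓(U, ℝ)) (l : Y →L[ℝ] ℝ) (v : Rn n) :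
    |V.derivFunctional ((l : C(Y, ℝ)).comp f') (TestFunction.smulVec v φ)| ≤
      M * ‖l‖ * ‖v‖ * ∫ x : U, |φ x| ∂V.weight := by
  refine le_of_tendsto
    (tendsto_derivFunctional_comp (V := V) hf l.continuous (TestFunction.smulVec v φ)).abs
    (.of_forall fun i => ?_)
  have h1 := (hF i).eq_integral_smulVec l v φ
  refine (congrArg abs h1).le.trans ?_
  rw [← integral_const_mul, ← Real.norm_eq_abs]
  refine norm_integral_le_of_norm_le ((φ.integrable_restrict V.weight).abs.const_mul _) ?_
  filter_upwards [hFb i] with x hx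
  rw [norm_mul, mul_comm, Real.norm_eq_abs (φ x)]
  refine mul_le_mul_of_nonneg_right ?_ (abs_nonneg _)
  calc ‖l (F i x v)‖ ≤ ‖l‖ * (‖F i x‖ * ‖v‖) :=
        (l.le_opNorm _).trans (mul_le_mul_of_nonneg_left ((F i x).le_opNorm v) (norm_nonneg _))
    _ ≤ ‖l‖ * (M * ‖v‖) := by gcongr
    _ = M * ‖l‖ * ‖v‖ := by ring

end Varifold

end

/-! ### The two statements on locally Lipschitzian functions -/

theorem mainTheorem8 {m n : ℕ} (hm : 0 < m) (hmn : m ≤ n) (U : Opens (Rn n))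
    (V : Varifold m U) (hV : IsFiniteMeasureOnCompacts V.variation)
    {Y : Type*} [NormedAddCommGroup Y] [NormedSpace ℝ Y] [FiniteDimensional ℝ Y] :
    (∀ f : U → Y, LocallyLipschitz f →
      V.IsWeaklyDiff f ∧
      ∀ F : U → (Rn n →L[ℝ] Y), V.IsWeakDeriv f F →
        ∀ᵐ x ∂V.weight, ∃ L : ℝ≥0∞,
          Tendsto (fun r : ℝ => lipConst f (Metric.closedBall x r)) (𝓝[>] 0) (𝓝 L) ∧
          ‖F x‖ₑ ≤ L) ∧
    (∀ (f : ℕ → U → Y) (f' : U → Y) (F : ℕ → U → (Rn n →L[ℝ] Y)),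
      (∀ i, LocallyLipschitz (f i)) →
      TendstoLocallyUniformly f f' atTop →
      (∀ i, V.IsWeakDeriv (f i) (F i)) →
      (⨆ i, eLpNorm (F i) ∞ V.weight) < ∞ →
      V.IsWeaklyDiff f' ∧
      ∀ F' : U → (Rn n →L[ℝ] Y), V.IsWeakDeriv f' F' →
        eLpNorm F' ∞ V.weight ≤ ⨆ i, eLpNorm (F i) ∞ V.weight ∧
        ∀ G : U → ((Rn n →L[ℝ] Y) →L[ℝ] ℝ), Integrable G V.weight →
          Tendsto (fun i => ∫ x, G x (F i x) ∂V.weight) atTop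
            (𝓝 (∫ x, G x (F' x) ∂V.weight))) := by
  refine ⟨fun f hf => ⟨Varifold.exists_isWeakDeriv_of_locallyLipschitz (V := V)
    (f := ⟨f, hf.continuous⟩) hf, fun F hF => ?_⟩, fun f f' F hf hlim hF hκ => ?_⟩
  · have hF' : V.IsWeakDeriv (⟨f, hf.continuous⟩ : C(U, Y)) F := hF
    filter_upwards [hF'.hasLinearDeriv.ae_enorm_le_lipConst] with x hx
    have hmono : Monotone fun r : ℝ => lipConst f (Metric.closedBall x r) := fun r s hrs =>
      lipConst_mono f (Metric.closedBall_subset_closedBall hrs)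
    -- By monotonicity in `r` the limit is the infimum over positive radii, so a bound at every
    -- radius is enough.
    refine ⟨_, hmono.tendsto_nhdsGT 0, le_sInf ?_⟩
    rintro _ ⟨r, hr, rfl⟩
    exact hx r hr
  · have hf'c : Continuous f' := hlim.continuous (Frequently.of_forall fun i => (hf i).continuous)
    let g : ℕ → C(U, Y) := fun i => ⟨f i, (hf i).continuous⟩
    let g' : C(U, Y) := ⟨f', hf'c⟩
    have hg : ∀ K, IsCompact K → TendstoUniformlyOn (fun i x => g i x) g' atTop K :=
      tendstoLocallyUniformly_iff_forall_isCompact.1 hlim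
    have hFw : ∀ i, V.IsWeakDeriv (g i) (F i) := hF
    have hFl : ∀ i, V.HasLinearDeriv (g i) (F i) := fun i => (hFw i).hasLinearDeriv
    set κ := ⨆ i, eLpNorm (F i) ∞ V.weight with hκdef
    have hFb : ∀ i, ∀ᵐ x ∂V.weight, ‖F i x‖ ≤ κ.toReal := by
      intro i
      filter_upwards [enorm_ae_le_eLpNormEssSup (F i) V.weight] with x hx
      rw [← eLpNorm_exponent_top] at hx
      have h1 := ENNReal.toReal_mono hκ.ne
        (hx.trans (le_iSup (fun i => eLpNorm (F i) ∞ V.weight) i))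
      simpa using h1
    have hb := Varifold.abs_derivFunctional_le_of_tendsto hg hFl hFb
    -- Stated for every representative: it serves both the density constructed for existence and the
    -- arbitrary weak derivative in the conclusion, without appeal to uniqueness.
    have hbound : ∀ F' : U → (Rn n →L[ℝ] Y), V.HasLinearDeriv g' F' →
        ∀ᵐ x ∂V.weight, ‖F' x‖ ≤ κ.toReal := by
      intro F' hF'
      filter_upwards [hF'.ae_norm_le isOpen_univ ENNReal.toReal_nonneg fun φ l v _ => hb φ l v]
        with x hx using hx trivial
    have hmeas : ∀ i, AEStronglyMeasurable (fun z : U × Grass n m => F i z.1) V.measure := fun i =>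
      (hF i).measurable_deriv.comp_quasiMeasurePreserving V.quasiMeasurePreserving_fst
    have hFbV : ∀ i, ∀ᵐ z ∂V.measure, ‖F i z.1‖ ≤ κ.toReal := fun i =>
      V.quasiMeasurePreserving_fst.ae (hFb i)
    refine ⟨?_, fun F' hF' => ?_⟩
    · obtain ⟨F', hF'⟩ := Varifold.exists_hasLinearDeriv (V := V) (f := g') fun K _ =>
        ⟨κ.toReal, ENNReal.toReal_nonneg, fun φ l v _ => hb φ l v⟩
      exact ⟨F', Varifold.isWeakDeriv_of_hasChainRule hF'.locallyIntegrable
        (Varifold.hasChainRule_of_tendsto hg hmeas hFbV (fun i => (hFw i).hasChainRule) hF'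
          (hbound F' hF'))⟩
    · have hF'w : V.IsWeakDeriv g' F' := hF'
      have hF'b := hbound F' hF'w.hasLinearDeriv
      refine ⟨?_, fun G hG => ?_⟩
      · rw [← ENNReal.ofReal_toReal hκ.ne, eLpNorm_exponent_top]
        exact eLpNormEssSup_le_of_ae_bound hF'b
      · have h1 := Varifold.tendsto_integral_clm_of_hasChainRule hg hmeas hFbV
          (fun i => (hFw i).hasChainRule) hF'w.hasLinearDeriv hF'b hG
        have h2 : ∀ H : U → (Rn n →L[ℝ] Y), AEStronglyMeasurable H V.weight →
            ∫ x, G x (H x) ∂V.weight = ∫ z : U × Grass n m, G z.1 (H z.1) ∂V.measure :=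
          fun H hH => V.integral_weight
            ((ContinuousLinearMap.id ℝ ((Rn n →L[ℝ] Y) →L[ℝ] ℝ)).aestronglyMeasurable_comp₂
              hG.aestronglyMeasurable hH)
        rw [h2 F' hF'.measurable_deriv]
        simpa only [h2 _ (hF _).measurable_deriv] using h1
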